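/- Let $\mathcal X,\mathcal Y,\mathcal Z$ be finite sets and let $W_{YZ|X}$ be a discrete memoryless wiretap channel with input alphabet $\mathcal X$, main output alphabet $\mathcal Y$ and eavesdropper's output alphabet $\mathcal Z$. For every blocklength $n$ let $U_r=U_r^{(n)}$ be a random index on $\{1,\dots,K_n\}$ (for instance $K_n=2^{nR_r}$) with an arbitrary, possibly non-uniform, distribution $p_{U_r}$. All logarithms are in base $2$, and $R_2(U_r)=-\log\sum_k p_{U_r}(k)^2$. A code of blocklength $n$ and rate $R$ has $M_n=\lceil 2^{nR}\rceil$ messages, an encoder $e:\{1,\dots,M_n\}\times\{1,\dots,K_n\}\to\mathcal X^n$ and a decoder $f:\mathcal Y^n\to\{1,\dots,M_n\}\cup\{?\}$. The message $M$ is uniform and independent of $U_r$; the codeword $e(M,U_r)$, picked by the message and by the index $U_r$, which is the only randomness at the encoder, is sent over $n$ independent uses of the channel. The rate $R$ is achievable with randomness $U_r$ if there is a sequence of such codes for which both the average error probability $\mathbb P[f(Y^n)\ne M]$ and the leakage $I(M;Z^n)$ tend to $0$ as $n\to\infty$. Then every rate $$R<\sup_{p\in\mathcal P}\bigl(I(X;Y|U)-I(X;Z|U)\bigr)$$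 is achievable with randomness $U_r$, where $\mathcal P$ is the set of all distributions $p_{UXYZ}$, with $U$ ranging over arbitrary finite alphabets, that factorize as $p_U\,p_{X|U}\,W_{YZ|X}$ and satisfy $I(X;Z|U)<\frac1n R_2(U_r)$ for all sufficiently large $n$. -/

import Mathlib

open Filter Topology

noncomputable section

namespace Wiretap

/-- Mutual information `I(A;B)` (in bits) of a pair with joint law `p` on a finite product.
Terms with `p (a, b) = 0` contribute `0`. -/
def mutualInfo {A B : Type*} [Fintype A] [Fintype B] (p : A × B → ℝ) : ℝ :=
  ∑ a, ∑ b, p (a, b) * Real.logb 2 (p (a, b) / ((∑ b', p (a, b')) * (∑ a', p (a', b))))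

/-- Conditional mutual information `I(A;B|C)` (in bits) of a triple `(C, A, B)` with joint law `p`:
`∑ p(c,a,b) log (p(a,b|c) / (p(a|c) p(b|c)))`, with both sides of the fraction multiplied by
`p(c) ^ 2`. Terms with `p (c, a, b) = 0` contribute `0`. -/
def condMutualInfo {C A B : Type*} [Fintype C] [Fintype A] [Fintype B]
    (p : C × A × B → ℝ) : ℝ :=
  ∑ c, ∑ a, ∑ b, p (c, a, b) * Real.logb 2
    ((p (c, a, b) * ∑ a', ∑ b', p (c, a', b')) /
      ((∑ b', p (c, a, b')) * (∑ a', p (c, a', b))))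

/-- Rényi entropy of order two (in bits) of a law `p` on a finite set. -/
def renyiTwo {K : Type*} [Fintype K] (p : K → ℝ) : ℝ :=
  -Real.logb 2 (∑ u, p u ^ 2)

/-- A code of blocklength `n` with `M` messages whose encoder picks the codeword by the message
and by the value of a local random index with `K` values. The decoder may declare an
error (`none`). -/
structure Code (X Y : Type*) (M K n : ℕ) where
  /-- the encoding function -/
  enc : Fin M → Fin K → Fin n → X
  /-- the decoding function -/
  dec : (Fin n → Y) → Option (Fin M)

section

variable {X Y Z : Type*} [Fintype X] [Fintype Y] [Fintype Z]

/-- Joint law of (message, random index, main output, eavesdropper's output): the message is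
uniform, the index has law `q` and is independent of the message, and the codeword is sent over
`n` independent uses of the channel `W`. -/
def Code.law {M K n : ℕ} (c : Code X Y M K n) (W : X → Y × Z → ℝ) (q : Fin K → ℝ)
    (m : Fin M) (k : Fin K) (y : Fin n → Y) (z : Fin n → Z) : ℝ :=
  (1 / (M : ℝ)) * q k * ∏ i, W (c.enc m k i) (y i, z i)

/-- Average probability of error of the main receiver. -/
def Code.errorProb {M K n : ℕ} (c : Code X Y M K n) (W : X → Y × Z → ℝ) (q : Fin K → ℝ) : ℝ :=
  ∑ m, ∑ k, ∑ y : Fin n → Y, ∑ z : Fin n → Z,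
    if c.dec y = some m then 0 else c.law W q m k y z

/-- Secrecy leakage `I(M;Z^n)`. -/
def Code.leakage {M K n : ℕ} (c : Code X Y M K n) (W : X → Y × Z → ℝ) (q : Fin K → ℝ) : ℝ :=
  mutualInfo (fun mz : Fin M × (Fin n → Z) =>
    ∑ k, ∑ y : Fin n → Y, c.law W q mz.1 k y mz.2)

/-- The rate `R` is achievable over `W` (reliably and with strong secrecy) when at blocklength `n`
the encoder's only randomness is an index with law `q n` on `K n` values. -/
def IsAchievable (W : X → Y × Z → ℝ) (K : ℕ → ℕ) (q : ∀ n, Fin (K n) → ℝ) (R : ℝ) : Prop :=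
  ∃ c : ∀ n : ℕ, Code X Y ⌈(2 : ℝ) ^ ((n : ℝ) * R)⌉₊ (K n) n,
    Tendsto (fun n => (c n).errorProb W (q n)) atTop (𝓝 0) ∧
    Tendsto (fun n => (c n).leakage W (q n)) atTop (𝓝 0)

/-- `I(X;Y|U)` for a law `p` of `(U, X, Y, Z)`. -/
def infoXY {U : Type*} [Fintype U] (p : U × X × Y × Z → ℝ) : ℝ :=
  condMutualInfo (fun t : U × X × Y => ∑ z, p (t.1, t.2.1, t.2.2, z))

/-- `I(X;Z|U)` for a law `p` of `(U, X, Y, Z)`. -/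
def infoXZ {U : Type*} [Fintype U] (p : U × X × Y × Z → ℝ) : ℝ :=
  condMutualInfo (fun t : U × X × Z => ∑ y, p (t.1, t.2.1, y, t.2.2))

/-- The laws of `(U, X, Y, Z)`, with `U` taking values in a set of `l` elements, that factorize as
`p_U p_{X|U} W_{YZ|X}` and satisfy `I(X;Z|U) < (1/n) R₂(q n)` for all large `n`. -/
def admissible (W : X → Y × Z → ℝ) (K : ℕ → ℕ) (q : ∀ n, Fin (K n) → ℝ) (l : ℕ) :
    Set (Fin l × X × Y × Z → ℝ) :=
  {p | (∃ pU ∈ stdSimplex ℝ (Fin l), ∃ pXU : Fin l → X → ℝ,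
          (∀ u, pXU u ∈ stdSimplex ℝ X) ∧
          ∀ u x y z, p (u, x, y, z) = pU u * pXU u x * W x (y, z)) ∧
        ∀ᶠ n : ℕ in atTop, infoXZ p < (1 / (n : ℝ)) * renyiTwo (q n)}

end

end Wiretap

end

/-! The code is random. Given a time-sharing sequence `u`, one codeword is drawn for each pair
(message, bin), with independent letters from `p_{X|U=u_i}`. The encoder hashes its index into `L ≈
exp(nα)` bins and sends the codeword of the pair. Hashing is needed because `K n` may be huge: the
main receiver's union bound runs over all codewords, and there are only `M * L` of them. A random
hash keeps the collision probability `κ` of the bin at most `∑ q² + 1/L ≤ 2 exp(-nα)`, and `κ` is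
all that secrecy uses of the non-uniform law.

Reliability is threshold decoding (`sum_iid_error_le`): the error decays when `R + α < I(X;Y|U)`, in
nats. For secrecy, the leakage is at most the mean divergence of the eavesdropper's conditional
output laws from the ensemble output law. Soft covering (`sum_iid_divergence_le`) bounds its
expectation by `E log(1 + κ(ρ - 1))`, with `ρ` the likelihood ratio, and this is at most `E (κρ)^s /
s`. Both exponents become single-letter and are made negative by a small tilt `s`
(`exists_tilt_lt_one`); for secrecy this requires `I(X;Z|U) < α`.

The hypothesis on `R₂` leaves no uniform margin: `R₂/n` may tend to `I(X;Z|U)`, so the only safe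
choice is `α = I(X;Z|U)`. The margin comes from sending a constant symbol a small fraction of the
time. This scales both informations by the same factor below one (`natInfo_timeShare`), making the
leaked information strictly smaller than `α` while the strict inequality for `R` absorbs the loss.
If `I(X;Z|U) = 0` there is nothing to gain, but then `ρ = 1` almost surely and the leakage bound
vanishes exactly. -/

namespace Wiretap

/-! ### I.i.d. families, the averaging argument, and random hashing. -/

section ProductLaw

variable {ι A B : Type*} [Fintype ι] [DecidableEq ι] [Fintype A] [Fintype B]

theorem sum_pi_prod (F : ι → A → ℝ) : ∑ c : ι → A, ∏ i, F i (c i) = ∏ i, ∑ a, F i a := by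
  classical
  rw [Finset.prod_univ_sum, Fintype.piFinset_univ]

theorem sum_pi_prod_mem_stdSimplex {P : ι → A → ℝ} (hP : ∀ i, P i ∈ stdSimplex ℝ A) :
    (fun c : ι → A => ∏ i, P i (c i)) ∈ stdSimplex ℝ (ι → A) := by
  refine ⟨fun c => Finset.prod_nonneg fun i _ => (hP i).1 _, ?_⟩
  rw [sum_pi_prod]
  exact Finset.prod_eq_one fun i _ => (hP i).2

/-- Expectation of a function of one coordinate of an i.i.d. family. -/
theorem sum_iid_mul_apply {P : A → ℝ} (hP : ∑ a, P a = 1) (j : ι) (f : A → ℝ) :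
    ∑ c : ι → A, (∏ i, P (c i)) * f (c j) = ∑ a, P a * f a := by
  have h : ∀ c : ι → A, (∏ i, P (c i)) * f (c j)
      = ∏ i, (P (c i) * if i = j then f (c i) else 1) := by
    intro c
    rw [Finset.prod_mul_distrib]
    simp
  simp_rw [h]
  rw [sum_pi_prod (fun i a => P a * if i = j then f a else 1),
    Finset.prod_eq_single j]
  · simp
  · intro i _ hi
    simp [hi, hP]
  · simp

/-- Expectation of a product of functions of two distinct coordinates of an i.i.d. family. -/
theorem sum_iid_mul_apply_mul_apply {P : A → ℝ} (hP : ∑ a, P a = 1) {j j' : ι} (hj : j ≠ j')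
    (f g : A → ℝ) :
    ∑ c : ι → A, (∏ i, P (c i)) * (f (c j) * g (c j'))
      = (∑ a, P a * f a) * ∑ a, P a * g a := by
  have h : ∀ c : ι → A, (∏ i, P (c i)) * (f (c j) * g (c j'))
      = ∏ i, (P (c i) * ((if i = j then f (c i) else 1) * if i = j' then g (c i) else 1)) := by
    intro c
    rw [Finset.prod_mul_distrib, Finset.prod_mul_distrib]
    simp
  simp_rw [h]
  rw [sum_pi_prod (fun i a => P a * ((if i = j then f a else 1) * if i = j' then g a else 1)),
    Finset.prod_eq_mul j j' hj]
  · simp [hj, hj.symm]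
  · intro i _ hi
    simp [hi.1, hi.2, hP]
  · simp
  · simp

/-- The probabilistic method, used to fix the hash, the codebook and the time-sharing sequence. With
`f = 0` it merely produces a point of the support. -/
theorem exists_pos_le_of_sum_le {w f : A → ℝ} (hw : w ∈ stdSimplex ℝ A) {b : ℝ}
    (h : ∑ a, w a * f a ≤ b) : ∃ a, 0 < w a ∧ f a ≤ b := by
  by_contra! H
  have h1 : ∑ a, w a * b < ∑ a, w a * f a := by
    apply Finset.sum_lt_sum
    · intro a _
      rcases (hw.1 a).eq_or_lt with h0 | h0
      · simp [← h0]
      · exact mul_le_mul_of_nonneg_left (H a h0).le h0.le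
    · obtain ⟨a, ha⟩ : ∃ a, 0 < w a := by
        by_contra! h0
        have h2 := hw.2
        rw [Finset.sum_eq_zero fun a _ => le_antisymm (h0 a) (hw.1 a)] at h2
        exact zero_ne_one h2
      exact ⟨a, Finset.mem_univ a, mul_lt_mul_of_pos_left (H a ha) ha⟩
  rw [← Finset.sum_mul, hw.2, one_mul] at h1
  linarith

/-- Law of the image of a random variable under a map. -/
def pushLaw (q : A → ℝ) [DecidableEq B] (g : A → B) (b : B) : ℝ :=
  ∑ a, if g a = b then q a else 0

theorem sum_pushLaw_mul [DecidableEq B] (q : A → ℝ) (g : A → B) (f : B → ℝ) :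
    ∑ b, pushLaw q g b * f b = ∑ a, q a * f (g a) := by
  simp only [pushLaw, Finset.sum_mul]
  rw [Finset.sum_comm]
  refine Finset.sum_congr rfl fun a _ => ?_
  simp [ite_mul]

theorem pushLaw_mem_stdSimplex [DecidableEq B] {q : A → ℝ} (hq : q ∈ stdSimplex ℝ A) (g : A → B) :
    pushLaw q g ∈ stdSimplex ℝ B := by
  refine ⟨fun b => Finset.sum_nonneg fun a _ => ?_, ?_⟩
  · split_ifs
    exacts [hq.1 a, le_rfl]
  · simpa [hq.2] using sum_pushLaw_mul q g 1

/-- A random hash into `B` has small collision probability. -/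
theorem exists_hash_collision_le [DecidableEq A] [DecidableEq B] [Nonempty B] {q : A → ℝ}
    (hq : q ∈ stdSimplex ℝ A) :
    ∃ g : A → B, ∑ b, pushLaw q g b ^ 2 ≤ ∑ a, q a ^ 2 + 1 / Fintype.card B := by
  set N : ℝ := ((Fintype.card B : ℕ) : ℝ) with hN
  have hN0 : 0 < N := by rw [hN]; exact_mod_cast Fintype.card_pos
  let P : B → ℝ := fun _ => 1 / N
  have hP : P ∈ stdSimplex ℝ B := by
    refine ⟨fun _ => by positivity, ?_⟩
    simp only [P, Finset.sum_const, Finset.card_univ, nsmul_eq_mul, ← hN]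
    field_simp
  have hsq : ∀ g : A → B, ∑ b, pushLaw q g b ^ 2
      = ∑ a, ∑ a', q a * q a' * if g a = g a' then 1 else 0 := by
    intro g
    simp_rw [sq]
    rw [sum_pushLaw_mul]
    refine Finset.sum_congr rfl fun a _ => ?_
    rw [pushLaw, Finset.mul_sum]
    refine Finset.sum_congr rfl fun a' _ => ?_
    by_cases h : g a' = g a
    · simp [h]
    · simp [h, Ne.symm h]
  have key : ∑ g : A → B, (∏ a, P (g a)) * ∑ b, pushLaw q g b ^ 2
      ≤ ∑ a, q a ^ 2 + 1 / N := by
    -- Distinct values collide with probability exactly `1 / N`; the bound overcounts the diagonal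
    -- so as to have one formula for all pairs.
    have hpair : ∀ a a', ∑ g : A → B, (∏ i, P (g i)) * (if g a = g a' then (1 : ℝ) else 0)
        ≤ (if a = a' then 1 else 0) + 1 / N := by
      intro a a'
      by_cases h : a = a'
      · subst h
        have := (sum_pi_prod_mem_stdSimplex (ι := A) (fun _ => hP)).2
        simp only [if_true, mul_one] at this ⊢
        rw [this]
        have : 0 < 1 / N := by positivity
        linarith
      · have h1 : ∀ g : A → B, (if g a = g a' then (1 : ℝ) else 0)
            = ∑ b, (if g a = b then 1 else 0) * (if g a' = b then 1 else 0) := by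
          intro g
          by_cases hg : g a = g a'
          · simp [hg]
          · simp [hg]
        simp_rw [h1, Finset.mul_sum]
        rw [Finset.sum_comm]
        have h2 : ∀ b : B, ∑ g : A → B, (∏ i, P (g i)) *
            ((if g a = b then (1 : ℝ) else 0) * (if g a' = b then 1 else 0)) = 1 / N * (1 / N) := by
          intro b
          rw [sum_iid_mul_apply_mul_apply hP.2 h (fun x => if x = b then 1 else 0)
            (fun x => if x = b then 1 else 0)]
          simp [P]
        simp_rw [h2]
        simp only [Finset.sum_const, Finset.card_univ, nsmul_eq_mul, ← hN, h, if_false, zero_add]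
        apply le_of_eq
        field_simp
    calc ∑ g : A → B, (∏ a, P (g a)) * ∑ b, pushLaw q g b ^ 2
        = ∑ a, ∑ a', q a * q a' *
            ∑ g : A → B, (∏ i, P (g i)) * (if g a = g a' then (1 : ℝ) else 0) := by
          simp_rw [hsq, Finset.mul_sum]
          rw [Finset.sum_comm]
          refine Finset.sum_congr rfl fun a _ => ?_
          rw [Finset.sum_comm]
          refine Finset.sum_congr rfl fun a' _ => Finset.sum_congr rfl fun g _ => ?_
          ring
      _ ≤ ∑ a, ∑ a', q a * q a' * ((if a = a' then 1 else 0) + 1 / N) :=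
          Finset.sum_le_sum fun a _ => Finset.sum_le_sum fun a' _ =>
            mul_le_mul_of_nonneg_left (hpair a a') (mul_nonneg (hq.1 a) (hq.1 a'))
      _ = ∑ a, q a ^ 2 + 1 / N := by
          simp_rw [mul_add, Finset.sum_add_distrib]
          congr 1
          · simp [sq]
          · simp_rw [← Finset.sum_mul, ← Finset.mul_sum, hq.2]
            simp [hq.2]
  obtain ⟨g, -, hg⟩ := exists_pos_le_of_sum_le
    (sum_pi_prod_mem_stdSimplex (ι := A) (fun _ => hP)) key
  exact ⟨g, hg⟩

theorem sum_sq_le_one {r : A → ℝ} (hr : r ∈ stdSimplex ℝ A) : ∑ a, r a ^ 2 ≤ 1 := by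
  rw [← hr.2]
  refine Finset.sum_le_sum fun a _ => ?_
  have h1 : r a ≤ 1 := hr.2 ▸ Finset.single_le_sum (fun i _ => hr.1 i) (Finset.mem_univ a)
  nlinarith [hr.1 a]

theorem sum_sq_pos {r : A → ℝ} (hr : r ∈ stdSimplex ℝ A) : 0 < ∑ a, r a ^ 2 := by
  obtain ⟨a, ha, -⟩ := exists_pos_le_of_sum_le (f := 0) (b := 0) hr (by simp)
  exact Finset.sum_pos' (fun i _ => sq_nonneg _) ⟨a, Finset.mem_univ a, by positivity⟩

end ProductLaw

/-! ### Output law of a channel. -/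

section OneShot

variable {J A Z σ : Type*} [Fintype J] [DecidableEq J] [Fintype A] [Fintype Z] [Fintype σ]

/-- Law of the output of the channel `V` for an input of law `P`. -/
def outLaw (P : A → ℝ) (V : A → Z → ℝ) (z : Z) : ℝ := ∑ a, P a * V a z

theorem outLaw_mem_stdSimplex {P : A → ℝ} (hP : P ∈ stdSimplex ℝ A) {V : A → Z → ℝ}
    (hV : ∀ a, V a ∈ stdSimplex ℝ Z) : outLaw P V ∈ stdSimplex ℝ Z := by
  refine ⟨fun z => Finset.sum_nonneg fun a _ => mul_nonneg (hP.1 a) ((hV a).1 z), ?_⟩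
  simp only [outLaw]
  rw [Finset.sum_comm]
  simp_rw [← Finset.mul_sum, (hV _).2, mul_one, hP.2]

theorem mul_le_outLaw {P : A → ℝ} (hP : P ∈ stdSimplex ℝ A) {V : A → Z → ℝ}
    (hV : ∀ a, V a ∈ stdSimplex ℝ Z) (a : A) (z : Z) : P a * V a z ≤ outLaw P V z :=
  Finset.single_le_sum (f := fun a => P a * V a z)
    (fun i _ => mul_nonneg (hP.1 i) ((hV i).1 z)) (Finset.mem_univ a)


end OneShot

/-! ### Soft covering and the leakage of a codebook. -/

section Leakage

variable {J A Z σ ι : Type*} [Fintype J] [DecidableEq J] [Fintype A]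

theorem sum_iid_mul_pair [DecidableEq σ] {P : A → ℝ} (hP : ∑ a, P a = 1) {e : σ → J}
    (he : Function.Injective e) (f h : A → ℝ) (hh : ∑ a, P a * h a = 0) (j j' : σ) :
    ∑ c : J → A, (∏ i, P (c i)) * (f (c (e j)) * h (c (e j')))
      = if j = j' then ∑ a, P a * (f a * h a) else 0 := by
  split_ifs with hj
  · subst hj
    exact sum_iid_mul_apply hP (e j) fun a => f a * h a
  · rw [sum_iid_mul_apply_mul_apply hP (he.ne hj), hh, mul_zero]

variable [Fintype Z] [Fintype σ] [Fintype ι]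

/-- Off-diagonal terms vanish by independence, since `h` is centered and `e` injective. The diagonal
contributes `∑ r j ^ 2` times `E[f h]`, and so does the subtracted term because `r` sums to one. -/
theorem sum_iid_mul_centered_eq_zero {P : A → ℝ} (hP : ∑ a, P a = 1) {e : σ → J}
    (he : Function.Injective e) (f h : A → ℝ) (hh : ∑ a, P a * h a = 0) {r : σ → ℝ}
    (hr : ∑ j, r j = 1) :
    ∑ c : J → A, (∏ i, P (c i)) * ∑ j, r j * (f (c (e j)) *
      (∑ j', r j' * h (c (e j')) - (∑ j', r j' ^ 2) * h (c (e j)))) = 0 := by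
  classical
  have h1 : ∀ c : J → A, (∏ i, P (c i)) * ∑ j, r j * (f (c (e j)) *
      (∑ j', r j' * h (c (e j')) - (∑ j', r j' ^ 2) * h (c (e j))))
      = ∑ j, ∑ j', r j * r j' * ((∏ i, P (c i)) * (f (c (e j)) * h (c (e j'))))
        - ∑ j, (∑ j', r j' ^ 2) * r j * ((∏ i, P (c i)) * (f (c (e j)) * h (c (e j)))) := by
    intro c
    rw [← Finset.sum_sub_distrib, Finset.mul_sum]
    refine Finset.sum_congr rfl fun j _ => ?_
    rw [mul_sub, mul_sub, mul_sub, Finset.mul_sum, Finset.mul_sum, Finset.mul_sum]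
    congr 1
    · exact Finset.sum_congr rfl fun j' _ => by ring
    · ring
  simp_rw [h1]
  rw [Finset.sum_sub_distrib, Finset.sum_comm]
  have h2 : ∀ j, ∑ c : J → A, ∑ j', r j * r j' *
      ((∏ i, P (c i)) * (f (c (e j)) * h (c (e j')))) = r j ^ 2 * ∑ a, P a * (f a * h a) := by
    intro j
    rw [Finset.sum_comm]
    simp_rw [← Finset.mul_sum, sum_iid_mul_pair hP he f h hh, mul_ite, mul_zero,
      Finset.sum_ite_eq, Finset.mem_univ, if_true, ← sq]
  simp_rw [h2]
  rw [Finset.sum_comm (f := fun (c : J → A) j => (∑ j', r j' ^ 2) * r j *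
    ((∏ i, P (c i)) * (f (c (e j)) * h (c (e j)))))]
  simp_rw [← Finset.mul_sum, sum_iid_mul_pair hP he f h hh, if_true]
  rw [← Finset.sum_mul, ← Finset.sum_mul, ← Finset.mul_sum, hr, mul_one, sub_self]

/-- Concavity: the graph of `log` lies below its tangent at `t`. The tangent replaces Jensen's
inequality in soft covering. -/
theorem log_le_log_add_sub_div {x t : ℝ} (hx : 0 < x) (ht : 0 < t) :
    Real.log x ≤ Real.log t + (x - t) / t := by
  have := Real.log_le_sub_one_of_pos (div_pos hx ht)
  rw [Real.log_div hx.ne' ht.ne'] at this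
  rw [sub_div, div_self ht.ne']
  linarith

theorem one_add_mul_sub_pos {κ x : ℝ} (hκ : 0 < κ) (hκ1 : κ ≤ 1) (hx : 0 < x) :
    0 < 1 + κ * (x - 1) := by
  nlinarith [mul_pos hκ hx]

/-- Soft covering with a non-uniform index: expected divergence between the output law induced by
a random codebook, and the output law of the ensemble, in terms of the collision probability. -/
theorem sum_iid_divergence_le {P : A → ℝ} (hP : P ∈ stdSimplex ℝ A) {V : A → Z → ℝ}
    (hV : ∀ a, V a ∈ stdSimplex ℝ Z) {e : σ → J} (he : Function.Injective e) {r : σ → ℝ}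
    (hr : r ∈ stdSimplex ℝ σ) :
    ∑ c : J → A, (∏ i, P (c i)) * ∑ z, (∑ j, r j * V (c (e j)) z) *
        Real.log ((∑ j, r j * V (c (e j)) z) / outLaw P V z)
      ≤ ∑ a, ∑ z, P a * V a z *
        Real.log (1 + (∑ j, r j ^ 2) * (V a z / outLaw P V z - 1)) := by
  set κ := ∑ j, r j ^ 2 with hκ
  have hκ0 : 0 < κ := sum_sq_pos hr
  have hκ1 : κ ≤ 1 := sum_sq_le_one hr
  simp_rw [Finset.mul_sum]
  rw [Finset.sum_comm, Finset.sum_comm (s := (Finset.univ : Finset A))]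
  refine Finset.sum_le_sum fun z _ => ?_
  set Q := outLaw P V z with hQ
  have hPV : ∀ a, P a * V a z ≤ Q := fun a => mul_le_outLaw hP hV a z
  have hPV0 : ∀ a, 0 ≤ P a * V a z := fun a => mul_nonneg (hP.1 a) ((hV a).1 z)
  have hQ0 : 0 ≤ Q := (outLaw_mem_stdSimplex hP hV).1 z
  rcases hQ0.eq_or_lt with hQ0 | hQ0
  -- Division by zero and `Real.log 0` both give `0`, so an output that the ensemble never produces
  -- contributes nothing to either side.
  · have h0 : ∀ a, P a * V a z = 0 := fun a =>
      le_antisymm (by rw [hQ0]; exact hPV a) (hPV0 a)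
    simp [h0, ← hQ0]
  -- The tangent point. Given that codeword `j` is `a`, the normalized output probability has mean
  -- `1 + r j * (V a z / Q - 1)`. Replacing `r j` by its `r`-average `κ` makes the tangent point
  -- independent of `j`, and the linear corrections still cancel after averaging over `j`.
  let t : A → ℝ := fun a => 1 + κ * (V a z / Q - 1)
  let f : A → ℝ := fun a => V a z / t a
  let h : A → ℝ := fun a => V a z / Q - 1
  have hh : ∑ a, P a * h a = 0 := by
    have : ∀ a, P a * h a = P a * V a z / Q - P a := fun a => by simp only [h]; ring
    simp_rw [this]
    rw [Finset.sum_sub_distrib, ← Finset.sum_div, hP.2]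
    change Q / Q - 1 = 0
    rw [div_self hQ0.ne', sub_self]
  have hω : ∀ c : J → A, 0 ≤ ∏ i, P (c i) := fun c => Finset.prod_nonneg fun i _ => hP.1 _
  have hsumV : ∀ c : J → A, ∑ j, r j * h (c (e j)) = (∑ j, r j * V (c (e j)) z) / Q - 1 := by
    intro c
    simp only [h, mul_sub, mul_one, Finset.sum_sub_distrib, hr.2, Finset.sum_div, mul_div_assoc]
  have key : ∀ c : J → A, (∏ i, P (c i)) * ((∑ j, r j * V (c (e j)) z) *
        Real.log ((∑ j, r j * V (c (e j)) z) / Q))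
      ≤ (∏ i, P (c i)) * (∑ j, r j * (V (c (e j)) z * Real.log (t (c (e j))))) +
        (∏ i, P (c i)) * ∑ j, r j * (f (c (e j)) *
          (∑ j', r j' * h (c (e j')) - κ * h (c (e j)))) := by
    intro c
    rw [← mul_add]
    refine mul_le_mul_of_nonneg_left ?_ (hω c)
    rw [hsumV, Finset.sum_mul, ← Finset.sum_add_distrib]
    refine Finset.sum_le_sum fun j _ => ?_
    rcases (hr.1 j).eq_or_lt with hrj | hrj
    · simp [← hrj]
    rcases ((hV (c (e j))).1 z).eq_or_lt with hVj | hVj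
    · simp [← hVj, f]
    have ht : 0 < t (c (e j)) := one_add_mul_sub_pos hκ0 hκ1 (div_pos hVj hQ0)
    have hS : 0 < ∑ j, r j * V (c (e j)) z :=
      Finset.sum_pos' (fun i _ => mul_nonneg (hr.1 i) ((hV _).1 z))
        ⟨j, Finset.mem_univ j, mul_pos hrj hVj⟩
    have h1 := mul_le_mul_of_nonneg_left
      (log_le_log_add_sub_div (div_pos hS hQ0) ht) (mul_pos hrj hVj).le
    refine h1.trans (le_of_eq ?_)
    simp only [f, t, h]
    field_simp
    ring
  refine (Finset.sum_le_sum fun c _ => key c).trans ?_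
  rw [Finset.sum_add_distrib, sum_iid_mul_centered_eq_zero hP.2 he f h hh hr.2, add_zero]
  apply le_of_eq
  simp_rw [Finset.mul_sum]
  rw [Finset.sum_comm]
  have h3 : ∀ j, ∑ c : J → A, (∏ i, P (c i)) * (r j * (V (c (e j)) z * Real.log (t (c (e j)))))
      = r j * ∑ a, P a * V a z * Real.log (t a) := by
    intro j
    rw [sum_iid_mul_apply hP.2 (e j) (fun a => r j * (V a z * Real.log (t a))), Finset.mul_sum]
    exact Finset.sum_congr rfl fun a _ => by ring
  simp_rw [h3]
  rw [← Finset.sum_mul, hr.2, one_mul]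

/-- Gibbs' inequality before summation, from `log x ≤ x - 1` at `x = q / p`. -/
theorem mul_log_div_ge_sub {p q : ℝ} (hp : 0 ≤ p) (hq : 0 ≤ q) (h : q = 0 → p = 0) :
    p - q ≤ p * Real.log (p / q) := by
  rcases hp.eq_or_lt with hp | hp
  · simp [← hp, hq]
  have hq' : 0 < q := lt_of_le_of_ne hq fun h0 => hp.ne' (h h0.symm)
  have h1 := mul_le_mul_of_nonneg_left (Real.log_le_sub_one_of_pos (div_pos hq' hp)) hp.le
  rw [Real.log_div hq'.ne' hp.ne', mul_sub, mul_sub, mul_div_cancel₀ _ hp.ne'] at h1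
  rw [Real.log_div hp.ne' hq'.ne', mul_sub]
  linarith

theorem mutualInfo_nonneg {p : ι × Z → ℝ} (hp : p ∈ stdSimplex ℝ (ι × Z)) :
    0 ≤ mutualInfo p := by
  have hl : 0 < Real.log 2 := Real.log_pos one_lt_two
  have hsum : ∑ a, ∑ b, p (a, b) = 1 := by rw [← hp.2, Fintype.sum_prod_type]
  have hterm : ∀ a b, p (a, b) - (∑ b', p (a, b')) * (∑ a', p (a', b))
      ≤ p (a, b) * Real.log (p (a, b) / ((∑ b', p (a, b')) * (∑ a', p (a', b)))) := by
    intro a b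
    have ha : p (a, b) ≤ ∑ b', p (a, b') :=
      Finset.single_le_sum (f := fun b' => p (a, b')) (fun i _ => hp.1 _) (Finset.mem_univ b)
    have hb : p (a, b) ≤ ∑ a', p (a', b) :=
      Finset.single_le_sum (f := fun a' => p (a', b)) (fun i _ => hp.1 _) (Finset.mem_univ a)
    have h0 := hp.1 (a, b)
    refine mul_log_div_ge_sub h0 (mul_nonneg (h0.trans ha) (h0.trans hb)) fun h => ?_
    rcases mul_eq_zero.1 h with h | h
    · exact le_antisymm (h ▸ ha) h0
    · exact le_antisymm (h ▸ hb) h0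
  have h1 : 0 ≤ ∑ a, ∑ b, p (a, b) *
      Real.log (p (a, b) / ((∑ b', p (a, b')) * (∑ a', p (a', b)))) := by
    refine le_trans (le_of_eq ?_) (Finset.sum_le_sum fun a _ => Finset.sum_le_sum fun b _ => hterm a b)
    simp_rw [Finset.sum_sub_distrib, ← Finset.mul_sum]
    rw [← Finset.sum_mul, hsum, Finset.sum_comm (f := fun b a' => p (a', b)), hsum]
    simp
  have h2 : mutualInfo p = (∑ a, ∑ b, p (a, b) *
      Real.log (p (a, b) / ((∑ b', p (a, b')) * (∑ a', p (a', b))))) / Real.log 2 := by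
    simp only [mutualInfo, Real.logb, Finset.sum_div, mul_div_assoc]
  rw [h2]
  exact div_nonneg h1 hl.le

/-- Mutual information with a uniform first component is at most the average divergence of the
conditional laws from any fixed law. -/
theorem mutualInfo_uniform_mul_log_two_le [Nonempty ι] {S : ι → Z → ℝ}
    (hS : ∀ m, S m ∈ stdSimplex ℝ Z) {Q : Z → ℝ} (hQ : Q ∈ stdSimplex ℝ Z)
    (hSQ : ∀ m z, Q z = 0 → S m z = 0) :
    mutualInfo (fun mz : ι × Z => 1 / (Fintype.card ι : ℝ) * S mz.1 mz.2) * Real.log 2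
      ≤ ∑ m, 1 / (Fintype.card ι : ℝ) * ∑ z, S m z * Real.log (S m z / Q z) := by
  set N : ℝ := ((Fintype.card ι : ℕ) : ℝ) with hN
  have hN0 : 0 < N := by rw [hN]; exact_mod_cast Fintype.card_pos
  have hl : 0 < Real.log 2 := Real.log_pos one_lt_two
  let p : Z → ℝ := fun z => ∑ m, 1 / N * S m z
  have hp0 : ∀ z, 0 ≤ p z := fun z =>
    Finset.sum_nonneg fun m _ => mul_nonneg (by positivity) ((hS m).1 z)
  have hpsum : ∑ z, p z = 1 := by
    simp only [p]
    rw [Finset.sum_comm]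
    simp_rw [← Finset.mul_sum, (hS _).2]
    simp only [Finset.sum_const, Finset.card_univ, nsmul_eq_mul, ← hN]
    field_simp
  have hpQ : ∀ z, Q z = 0 → p z = 0 := fun z hz =>
    Finset.sum_eq_zero fun m _ => by rw [hSQ m z hz, mul_zero]
  have h1 : mutualInfo (fun mz : ι × Z => 1 / N * S mz.1 mz.2) * Real.log 2
      = ∑ m, ∑ z, 1 / N * S m z * Real.log (S m z / p z) := by
    simp only [mutualInfo, Real.logb]
    rw [Finset.sum_mul]
    refine Finset.sum_congr rfl fun m _ => ?_
    rw [Finset.sum_mul]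
    refine Finset.sum_congr rfl fun z _ => ?_
    rw [mul_assoc, div_mul_cancel₀ _ hl.ne', ← Finset.mul_sum (f := fun z => S m z), (hS m).2]
    congr 2
    change 1 / N * S m z / (1 / N * 1 * p z) = _
    rw [mul_one, mul_div_mul_left _ _ (by positivity)]
  -- Compensation identity: the average divergence from `Q` exceeds the one from the mixture `p`,
  -- which is the mutual information, by the divergence of `p` from `Q`.
  have h2 : ∀ m z, 1 / N * S m z * Real.log (S m z / p z)
      = 1 / N * (S m z * Real.log (S m z / Q z)) - 1 / N * S m z * Real.log (p z / Q z) := by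
    intro m z
    rcases ((hS m).1 z).eq_or_lt with h0 | h0
    · simp [← h0]
    have hq : Q z ≠ 0 := fun h => h0.ne' (hSQ m z h)
    have hpz : 0 < p z := Finset.sum_pos' (fun i _ => mul_nonneg (by positivity) ((hS i).1 z))
        ⟨m, Finset.mem_univ m, by positivity⟩
    rw [Real.log_div h0.ne' hpz.ne', Real.log_div h0.ne' hq, Real.log_div hpz.ne' hq]
    ring
  rw [h1]
  simp_rw [h2, Finset.sum_sub_distrib, ← Finset.mul_sum]
  rw [sub_le_self_iff, Finset.sum_comm]
  simp_rw [← Finset.sum_mul]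
  have h3 : ∑ z, (p z - Q z) ≤ ∑ z, p z * Real.log (p z / Q z) :=
    Finset.sum_le_sum fun z _ => mul_log_div_ge_sub (hp0 z) (hQ.1 z) (hpQ z)
  rwa [Finset.sum_sub_distrib, hpsum, hQ.2, sub_self] at h3

end Leakage

/-! ### Random coding for the main receiver. -/

section Error

variable {A Y σ ι : Type*} [Fintype σ] [Fintype ι] [DecidableEq ι]

open Classical in
/-- Threshold decoder: the unique message with a codeword whose likelihood ratio exceeds `τ`. -/
noncomputable def thresholdDec (V : A → Y → ℝ) (Q : Y → ℝ) (τ : ℝ) (c : ι × σ → A) (y : Y) : Option ι :=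
  if h : ∃! m, ∃ j, τ * Q y < V (c (m, j)) y then some h.choose else none

-- Union bound for one output: decoding fails only if the sent codeword misses the threshold or a
-- codeword of another message passes it. Other codewords of the same message are harmless, since
-- only the message must be unique.
open Classical in
theorem indicator_thresholdDec_ne_le (V : A → Y → ℝ) (Q : Y → ℝ) (τ : ℝ) (c : ι × σ → A) (y : Y)
    (m : ι) (j : σ) :
    (if thresholdDec V Q τ c y = some m then (0 : ℝ) else 1)
      ≤ (if τ * Q y < V (c (m, j)) y then 0 else 1) +
        ∑ i : ι × σ, if i.1 ≠ m then (if τ * Q y < V (c i) y then 1 else 0) else 0 := by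
  have hnn : ∀ i : ι × σ, (0 : ℝ) ≤
      if i.1 ≠ m then (if τ * Q y < V (c i) y then 1 else 0) else 0 := by
    intro i; split_ifs <;> norm_num
  have hs := Finset.sum_nonneg fun i (_ : i ∈ Finset.univ) => hnn i
  by_cases hd : thresholdDec V Q τ c y = some m
  · rw [if_pos hd]
    refine add_nonneg ?_ hs
    split_ifs <;> norm_num
  rw [if_neg hd]
  by_cases hg : τ * Q y < V (c (m, j)) y
  · rw [if_pos hg, zero_add]
    obtain ⟨m', hm', j', hj'⟩ : ∃ m', m' ≠ m ∧ ∃ j, τ * Q y < V (c (m', j)) y := by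
      by_contra! H
      have hu : ∀ m', (∃ j, τ * Q y < V (c (m', j)) y) → m' = m := by
        rintro m' ⟨j', hj'⟩
        by_contra hne
        exact absurd hj' (not_lt.2 (H m' hne j'))
      have hex : ∃! m, ∃ j, τ * Q y < V (c (m, j)) y := ⟨m, ⟨j, hg⟩, hu⟩
      apply hd
      rw [thresholdDec, dif_pos hex, hu _ hex.choose_spec.1]
    refine le_trans (le_of_eq ?_) (Finset.single_le_sum (fun i _ => hnn i) (Finset.mem_univ (m', j')))
    simp [hm', hj']
  · rw [if_neg hg]
    linarith

variable [Fintype A] [Fintype Y] [DecidableEq σ]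

/-- Random coding bound for threshold decoding. -/
theorem sum_iid_error_le {P : A → ℝ} (hP : P ∈ stdSimplex ℝ A) {V : A → Y → ℝ}
    (hV : ∀ a, V a ∈ stdSimplex ℝ Y) {τ s : ℝ} (hτ : 0 < τ) (hs : 0 < s) (m : ι) (j : σ) :
    ∑ c : ι × σ → A, (∏ i, P (c i)) * ∑ y, V (c (m, j)) y *
        (if thresholdDec V (outLaw P V) τ c y = some m then 0 else 1)
      ≤ Fintype.card ι * Fintype.card σ / τ +
        τ ^ s * ∑ a, ∑ y, P a * V a y * (V a y / outLaw P V y)⁻¹ ^ s := by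
  classical
  set Q := outLaw P V with hQ
  have hQ0 : ∀ y, 0 ≤ Q y := (outLaw_mem_stdSimplex hP hV).1
  have hω : ∀ c : ι × σ → A, 0 ≤ ∏ i, P (c i) := fun c => Finset.prod_nonneg fun i _ => hP.1 _
  let g : A → Y → ℝ := fun a y => if τ * Q y < V a y then 1 else 0
  have step : ∑ c : ι × σ → A, (∏ i, P (c i)) * ∑ y, V (c (m, j)) y *
        (if thresholdDec V Q τ c y = some m then 0 else 1)
      ≤ ∑ c : ι × σ → A, (∏ i, P (c i)) * (∑ y, V (c (m, j)) y * (1 - g (c (m, j)) y)) +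
        ∑ c : ι × σ → A, ∑ y, ∑ i : ι × σ,
          if i.1 ≠ m then (∏ i, P (c i)) * (V (c (m, j)) y * g (c i) y) else 0 := by
    rw [← Finset.sum_add_distrib]
    refine Finset.sum_le_sum fun c _ => ?_
    have h1 : ∑ y, ∑ i : ι × σ, (if i.1 ≠ m then (∏ i, P (c i)) * (V (c (m, j)) y * g (c i) y)
        else 0) = (∏ i, P (c i)) * ∑ y, V (c (m, j)) y *
          ∑ i : ι × σ, if i.1 ≠ m then g (c i) y else 0 := by
      simp_rw [Finset.mul_sum]
      refine Finset.sum_congr rfl fun y _ => Finset.sum_congr rfl fun i _ => ?_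
      split_ifs <;> simp
    rw [h1, ← mul_add, ← Finset.sum_add_distrib]
    refine mul_le_mul_of_nonneg_left (Finset.sum_le_sum fun y _ => ?_) (hω c)
    rw [← mul_add]
    refine mul_le_mul_of_nonneg_left ?_ ((hV _).1 y)
    refine (indicator_thresholdDec_ne_le V Q τ c y m j).trans (le_of_eq ?_)
    congr 1
    simp only [g]
    split_ifs <;> norm_num
  refine step.trans (le_trans (add_comm _ _).le (add_le_add ?_ ?_))
  · rw [Finset.sum_comm]
    have hpair : ∀ y (i : ι × σ), ∑ c : ι × σ → A,
        (if i.1 ≠ m then (∏ i, P (c i)) * (V (c (m, j)) y * g (c i) y) else 0)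
        ≤ ∑ a, P a * V a y / τ := by
      intro y i
      by_cases hi : i.1 ≠ m
      · simp only [if_pos hi]
        have hne : (m, j) ≠ i := fun h => hi (by rw [← h])
        rw [sum_iid_mul_apply_mul_apply hP.2 hne (fun a => V a y) (fun a => g a y)]
        -- A codeword of another message is independent of the sent one, so the output has law `Q`
        -- relative to it; where it passes the threshold, `Q y < V a y / τ`.
        change Q y * _ ≤ _
        rw [Finset.mul_sum]
        refine Finset.sum_le_sum fun a _ => ?_
        rw [le_div_iff₀ hτ]
        simp only [g]
        split_ifs with hgt
        · nlinarith [hP.1 a]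
        · simpa using mul_nonneg (hP.1 a) ((hV a).1 y)
      · simp only [if_neg hi, Finset.sum_const_zero]
        exact Finset.sum_nonneg fun a _ =>
          div_nonneg (mul_nonneg (hP.1 a) ((hV a).1 y)) hτ.le
    have h2 : ∀ y, ∑ c : ι × σ → A, ∑ i : ι × σ,
        (if i.1 ≠ m then (∏ i, P (c i)) * (V (c (m, j)) y * g (c i) y) else 0)
        ≤ Fintype.card ι * Fintype.card σ * (Q y / τ) := by
      intro y
      rw [Finset.sum_comm]
      refine (Finset.sum_le_sum fun i _ => hpair y i).trans (le_of_eq ?_)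
      rw [← Finset.sum_div]
      change ∑ _i : ι × σ, Q y / τ = _
      simp [Fintype.card_prod]
    refine (Finset.sum_le_sum fun y _ => h2 y).trans (le_of_eq ?_)
    rw [← Finset.mul_sum, ← Finset.sum_div, (outLaw_mem_stdSimplex hP hV).2, mul_one_div]
  · rw [sum_iid_mul_apply hP.2 (m, j) (fun a => ∑ y, V a y * (1 - g a y)), Finset.mul_sum]
    refine Finset.sum_le_sum fun a _ => ?_
    rw [Finset.mul_sum, Finset.mul_sum]
    refine Finset.sum_le_sum fun y _ => ?_
    have hPV := mul_nonneg (hP.1 a) ((hV a).1 y)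
    have hle : P a * V a y ≤ Q y := mul_le_outLaw hP hV a y
    rcases hPV.eq_or_lt with h0 | h0
    · rw [← mul_assoc, ← h0]; simp
    have hVpos : 0 < V a y := lt_of_le_of_ne ((hV a).1 y) fun h => by simp [← h] at h0
    have hQpos : 0 < Q y := h0.trans_le hle
    rw [← mul_assoc, mul_left_comm]
    refine mul_le_mul_of_nonneg_left ?_ hPV
    -- Chernoff bound: where the threshold is missed, `τ * Q y / V a y ≥ 1`, and so is its power
    -- `s`.
    rw [inv_div, ← Real.mul_rpow hτ.le (by positivity)]
    simp only [g]
    split_ifs with hgt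
    · simp only [sub_self]; positivity
    · rw [sub_zero]
      apply Real.one_le_rpow _ hs.le
      rw [← mul_div_assoc, one_le_div hVpos]
      exact not_lt.1 hgt

end Error

/-! ### Memoryless channels and product inputs. -/

section Block

variable {X Y Z U : Type*}

/-- Channel to the main receiver. -/
def mainChannel [Fintype Z] (W : X → Y × Z → ℝ) (x : X) (y : Y) : ℝ := ∑ z, W x (y, z)

/-- Channel to the eavesdropper. -/
def tapChannel [Fintype Y] (W : X → Y × Z → ℝ) (x : X) (z : Z) : ℝ := ∑ y, W x (y, z)

/-- `n` independent uses of a channel. -/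
def blockChannel {n : ℕ} (V : X → Y → ℝ) (x : Fin n → X) (y : Fin n → Y) : ℝ :=
  ∏ i, V (x i) (y i)

/-- Law of a vector with independent components. -/
def blockLaw {n : ℕ} (P : Fin n → X → ℝ) (x : Fin n → X) : ℝ := ∏ i, P i (x i)

theorem mainChannel_mem_stdSimplex [Fintype Y] [Fintype Z] {W : X → Y × Z → ℝ}
    (hW : ∀ x, W x ∈ stdSimplex ℝ (Y × Z)) (x : X) : mainChannel W x ∈ stdSimplex ℝ Y :=
  ⟨fun _ => Finset.sum_nonneg fun _ _ => (hW x).1 _, by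
    rw [← (hW x).2, Fintype.sum_prod_type]; rfl⟩

theorem tapChannel_mem_stdSimplex [Fintype Y] [Fintype Z] {W : X → Y × Z → ℝ}
    (hW : ∀ x, W x ∈ stdSimplex ℝ (Y × Z)) (x : X) : tapChannel W x ∈ stdSimplex ℝ Z :=
  ⟨fun _ => Finset.sum_nonneg fun _ _ => (hW x).1 _, by
    rw [← (hW x).2, Fintype.sum_prod_type_right]; rfl⟩

theorem blockChannel_mem_stdSimplex [Fintype Y] {n : ℕ} {V : X → Y → ℝ}
    (hV : ∀ x, V x ∈ stdSimplex ℝ Y) (x : Fin n → X) : blockChannel V x ∈ stdSimplex ℝ (Fin n → Y) :=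
  sum_pi_prod_mem_stdSimplex fun i => hV (x i)

theorem blockLaw_mem_stdSimplex [Fintype X] {n : ℕ} {P : Fin n → X → ℝ} (hP : ∀ i, P i ∈ stdSimplex ℝ X) :
    blockLaw P ∈ stdSimplex ℝ (Fin n → X) :=
  sum_pi_prod_mem_stdSimplex hP

theorem outLaw_blockLaw [Fintype X] {n : ℕ} (P : Fin n → X → ℝ) (V : X → Y → ℝ) (y : Fin n → Y) :
    outLaw (blockLaw P) (blockChannel V) y = ∏ i, outLaw (P i) V (y i) := by
  simp only [outLaw, blockLaw, blockChannel, ← Finset.prod_mul_distrib]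
  exact sum_pi_prod fun i a => P i a * V a (y i)

theorem sum_blockChannel_main [Fintype Z] {n : ℕ} (W : X → Y × Z → ℝ)
    (x : Fin n → X) (y : Fin n → Y) :
    ∑ z : Fin n → Z, ∏ i, W (x i) (y i, z i) = blockChannel (mainChannel W) x y :=
  sum_pi_prod fun i z => W (x i) (y i, z)

theorem sum_blockChannel_tap [Fintype Y] {n : ℕ} (W : X → Y × Z → ℝ)
    (x : Fin n → X) (z : Fin n → Z) :
    ∑ y : Fin n → Y, ∏ i, W (x i) (y i, z i) = blockChannel (tapChannel W) x z :=
  sum_pi_prod fun i y => W (x i) (y, z i)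

theorem sum_sum_sum_pow [Fintype U] [Fintype X] [Fintype Y] (n : ℕ) (F : U → X → Y → ℝ) :
    (∑ u, ∑ x, ∑ y, F u x y) ^ n
      = ∑ u : Fin n → U, ∑ x : Fin n → X, ∑ y : Fin n → Y, ∏ i, F (u i) (x i) (y i) := by
  have h : (∑ u, ∑ x, ∑ y, F u x y) ^ n = ∏ _i : Fin n, ∑ u, ∑ x, ∑ y, F u x y := by simp
  rw [h, ← sum_pi_prod (fun (_ : Fin n) u => ∑ x, ∑ y, F u x y)]
  refine Finset.sum_congr rfl fun u _ => ?_
  rw [← sum_pi_prod (fun (i : Fin n) x => ∑ y, F (u i) x y)]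
  refine Finset.sum_congr rfl fun x _ => ?_
  rw [← sum_pi_prod (fun (i : Fin n) y => F (u i) (x i) y)]

end Block

/-! ### From random codebooks to a wiretap code of given length. -/

section Codes

variable {X Y Z : Type*} [Fintype Y] [Fintype Z] {M K L n : ℕ}

theorem Code.errorProb_eq (c : Code X Y M K n) (W : X → Y × Z → ℝ) (q : Fin K → ℝ) :
    c.errorProb W q = ∑ m, ∑ k, 1 / (M : ℝ) * q k * ∑ y,
      blockChannel (mainChannel W) (c.enc m k) y * (if c.dec y = some m then 0 else 1) := by
  simp only [Code.errorProb, Code.law]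
  refine Finset.sum_congr rfl fun m _ => Finset.sum_congr rfl fun k _ => ?_
  rw [Finset.mul_sum]
  refine Finset.sum_congr rfl fun y _ => ?_
  split_ifs
  · simp
  · rw [← Finset.mul_sum, sum_blockChannel_main, mul_one]

theorem Code.errorProb_nonneg (c : Code X Y M K n) {W : X → Y × Z → ℝ}
    (hW : ∀ x, W x ∈ stdSimplex ℝ (Y × Z)) {q : Fin K → ℝ} (hq : q ∈ stdSimplex ℝ (Fin K)) :
    0 ≤ c.errorProb W q := by
  rw [Code.errorProb_eq]
  refine Finset.sum_nonneg fun m _ => Finset.sum_nonneg fun k _ =>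
    mul_nonneg (mul_nonneg (by positivity) (hq.1 k)) (Finset.sum_nonneg fun y _ => mul_nonneg
      ((blockChannel_mem_stdSimplex (mainChannel_mem_stdSimplex hW) _).1 y) ?_)
  split_ifs <;> norm_num

/-- Law of the eavesdropper's output given the message. -/
def Code.tapLaw (c : Code X Y M K n) (W : X → Y × Z → ℝ) (q : Fin K → ℝ) (m : Fin M)
    (z : Fin n → Z) : ℝ :=
  ∑ k, q k * blockChannel (tapChannel W) (c.enc m k) z

theorem Code.tapLaw_mem_stdSimplex (c : Code X Y M K n) {W : X → Y × Z → ℝ}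
    (hW : ∀ x, W x ∈ stdSimplex ℝ (Y × Z)) {q : Fin K → ℝ} (hq : q ∈ stdSimplex ℝ (Fin K))
    (m : Fin M) : c.tapLaw W q m ∈ stdSimplex ℝ (Fin n → Z) :=
  outLaw_mem_stdSimplex hq fun k =>
    blockChannel_mem_stdSimplex (tapChannel_mem_stdSimplex hW) (c.enc m k)

theorem Code.leakage_eq (c : Code X Y M K n) (W : X → Y × Z → ℝ) (q : Fin K → ℝ) :
    c.leakage W q = mutualInfo fun mz : Fin M × (Fin n → Z) =>
      1 / (Fintype.card (Fin M) : ℝ) * c.tapLaw W q mz.1 mz.2 := by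
  simp only [Code.leakage, Code.law, Code.tapLaw, Fintype.card_fin]
  congr 1
  funext mz
  rw [Finset.mul_sum]
  refine Finset.sum_congr rfl fun k _ => ?_
  rw [← Finset.mul_sum, sum_blockChannel_tap, mul_assoc]

theorem Code.leakage_nonneg [NeZero M] (c : Code X Y M K n) {W : X → Y × Z → ℝ}
    (hW : ∀ x, W x ∈ stdSimplex ℝ (Y × Z)) {q : Fin K → ℝ} (hq : q ∈ stdSimplex ℝ (Fin K)) :
    0 ≤ c.leakage W q := by
  rw [Code.leakage_eq]
  have hM : (M : ℝ) ≠ 0 := by exact_mod_cast NeZero.ne M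
  refine mutualInfo_nonneg ⟨fun mz => mul_nonneg (by positivity)
    ((c.tapLaw_mem_stdSimplex hW hq mz.1).1 mz.2), ?_⟩
  simp only [Fintype.sum_prod_type]
  simp_rw [← Finset.mul_sum, (c.tapLaw_mem_stdSimplex hW hq _).2]
  simp [hM]

variable [Fintype X]

/-- One-shot existence of a wiretap code in which the local random index is first hashed by `g`. -/
theorem exists_code_le [NeZero M] {W : X → Y × Z → ℝ}
    (hW : ∀ x, W x ∈ stdSimplex ℝ (Y × Z)) {q : Fin K → ℝ} (hq : q ∈ stdSimplex ℝ (Fin K))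
    (g : Fin K → Fin L) {P : (Fin n → X) → ℝ} (hP : P ∈ stdSimplex ℝ (Fin n → X))
    {τ s : ℝ} (hτ : 0 < τ) (hs : 0 < s) :
    ∃ c : Code X Y M K n, c.errorProb W q + c.leakage W q * Real.log 2 ≤
      (M * L / τ + τ ^ s * ∑ x, ∑ y, P x * blockChannel (mainChannel W) x y *
        (blockChannel (mainChannel W) x y / outLaw P (blockChannel (mainChannel W)) y)⁻¹ ^ s) +
      ∑ x, ∑ z, P x * blockChannel (tapChannel W) x z * Real.log (1 + (∑ j, pushLaw q g j ^ 2) *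
        (blockChannel (tapChannel W) x z / outLaw P (blockChannel (tapChannel W)) z - 1)) := by
  classical
  set VY : (Fin n → X) → (Fin n → Y) → ℝ := blockChannel (mainChannel W) with hVYdef
  set VZ : (Fin n → X) → (Fin n → Z) → ℝ := blockChannel (tapChannel W) with hVZdef
  have hVY : ∀ x, VY x ∈ stdSimplex ℝ (Fin n → Y) := fun x =>
    blockChannel_mem_stdSimplex (mainChannel_mem_stdSimplex hW) x
  have hVZ : ∀ x, VZ x ∈ stdSimplex ℝ (Fin n → Z) := fun x =>
    blockChannel_mem_stdSimplex (tapChannel_mem_stdSimplex hW) x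
  have hM : (M : ℝ) ≠ 0 := by exact_mod_cast NeZero.ne M
  have hM1 : ∑ _m : Fin M, 1 / (M : ℝ) = 1 := by simp [hM]
  have hr := pushLaw_mem_stdSimplex hq g
  set r := pushLaw q g with hrdef
  set be := M * L / τ + τ ^ s * ∑ x, ∑ y, P x * VY x y * (VY x y / outLaw P VY y)⁻¹ ^ s with hbe
  set bl := ∑ x, ∑ z, P x * VZ x z * Real.log (1 + (∑ j, r j ^ 2) * (VZ x z / outLaw P VZ z - 1))
    with hbl
  let code : (Fin M × Fin L → Fin n → X) → Code X Y M K n := fun c =>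
    ⟨fun m k => c (m, g k), thresholdDec VY (outLaw P VY) τ c⟩
  let ω : (Fin M × Fin L → Fin n → X) → ℝ := fun c => ∏ i, P (c i)
  have hω : ω ∈ stdSimplex ℝ (Fin M × Fin L → Fin n → X) :=
    sum_pi_prod_mem_stdSimplex fun _ => hP
  have herr : ∑ c, ω c * (code c).errorProb W q ≤ be := by
    have h1 : ∀ c, ω c * (code c).errorProb W q = ∑ m, ∑ k, 1 / (M : ℝ) * q k * (ω c *
        ∑ y, VY (c (m, g k)) y *
          (if thresholdDec VY (outLaw P VY) τ c y = some m then 0 else 1)) := by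
      intro c
      rw [Code.errorProb_eq, Finset.mul_sum]
      refine Finset.sum_congr rfl fun m _ => ?_
      rw [Finset.mul_sum]
      exact Finset.sum_congr rfl fun k _ => mul_left_comm _ _ _
    simp_rw [h1]
    rw [Finset.sum_comm]
    have h2 : ∀ m, ∑ c, ∑ k, 1 / (M : ℝ) * q k * (ω c *
        ∑ y, VY (c (m, g k)) y *
          (if thresholdDec VY (outLaw P VY) τ c y = some m then 0 else 1)) ≤ 1 / (M : ℝ) * be := by
      intro m
      rw [Finset.sum_comm]
      have h3 : ∀ k, ∑ c, 1 / (M : ℝ) * q k * (ω c *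
          ∑ y, VY (c (m, g k)) y *
            (if thresholdDec VY (outLaw P VY) τ c y = some m then 0 else 1))
          ≤ 1 / (M : ℝ) * q k * be := by
        intro k
        rw [← Finset.mul_sum]
        refine mul_le_mul_of_nonneg_left ?_ (mul_nonneg (by positivity) (hq.1 k))
        have := sum_iid_error_le hP hVY hτ hs m (g k)
        simpa only [Fintype.card_fin] using this
      refine (Finset.sum_le_sum fun k _ => h3 k).trans (le_of_eq ?_)
      rw [← Finset.sum_mul, ← Finset.mul_sum, hq.2, mul_one]
    refine (Finset.sum_le_sum fun m _ => h2 m).trans (le_of_eq ?_)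
    rw [← Finset.sum_mul, hM1, one_mul]
  have htap : ∀ c m z, (code c).tapLaw W q m z = ∑ j, r j * VZ (c (m, j)) z := fun c m z =>
    (sum_pushLaw_mul q g fun j => VZ (c (m, j)) z).symm
  have hleak : ∑ c, ω c * ((code c).leakage W q * Real.log 2) ≤ bl := by
    have h1 : ∀ c, ω c * ((code c).leakage W q * Real.log 2) ≤ ∑ m, 1 / (M : ℝ) * (ω c *
        ∑ z, (∑ j, r j * VZ (c (m, j)) z) *
          Real.log ((∑ j, r j * VZ (c (m, j)) z) / outLaw P VZ z)) := by
      intro c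
      simp_rw [mul_left_comm (1 / (M : ℝ)) (ω c)]
      rw [← Finset.mul_sum]
      -- Codebooks of probability zero are set aside: the divergence bound needs the output laws to
      -- be absolutely continuous with respect to the ensemble law, which holds when every codeword
      -- has positive probability.
      rcases (hω.1 c).eq_or_lt with h0 | h0
      · rw [← h0, zero_mul, zero_mul]
      refine mul_le_mul_of_nonneg_left ?_ h0.le
      rw [Code.leakage_eq]
      have hpos : ∀ i, P (c i) ≠ 0 := fun i hi =>
        h0.ne' (Finset.prod_eq_zero (Finset.mem_univ i) hi)
      have := mutualInfo_uniform_mul_log_two_le ((code c).tapLaw_mem_stdSimplex hW hq)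
        (outLaw_mem_stdSimplex hP hVZ) (fun m z hz => by
          rw [htap]
          refine Finset.sum_eq_zero fun j _ => ?_
          have h4 := mul_le_outLaw hP hVZ (c (m, j)) z
          rw [hz] at h4
          have h5 := le_antisymm h4 (mul_nonneg (hP.1 _) ((hVZ _).1 z))
          rw [(mul_eq_zero.1 h5).resolve_left (hpos _), mul_zero])
      simp only [htap, Fintype.card_fin] at this ⊢
      exact this
    refine (Finset.sum_le_sum fun c _ => h1 c).trans ?_
    rw [Finset.sum_comm]
    have h2 : ∀ m, ∑ c, 1 / (M : ℝ) * (ω c * ∑ z, (∑ j, r j * VZ (c (m, j)) z) *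
          Real.log ((∑ j, r j * VZ (c (m, j)) z) / outLaw P VZ z)) ≤ 1 / (M : ℝ) * bl := by
      intro m
      rw [← Finset.mul_sum]
      refine mul_le_mul_of_nonneg_left ?_ (by positivity)
      -- For fixed `m`, soft covering applies to the subcodebook of that message.
      exact sum_iid_divergence_le hP hVZ (e := fun j => (m, j))
        (fun j j' h => (Prod.mk.inj h).2) hr
    refine (Finset.sum_le_sum fun m _ => h2 m).trans (le_of_eq ?_)
    rw [← Finset.sum_mul, hM1, one_mul]
  obtain ⟨c, -, hc⟩ := exists_pos_le_of_sum_le hω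
    (f := fun c => (code c).errorProb W q + (code c).leakage W q * Real.log 2) (b := be + bl) (by
      simp_rw [mul_add, Finset.sum_add_distrib]
      exact add_le_add herr hleak)
  exact ⟨code c, hc⟩

end Codes

/-! ### Single-letter information and tilted exponents. -/

section Exponents

variable {X Y U : Type*}

/-- Law of `(U, X, Y)` when `Y` is the output of the channel `V` for the input `X`. -/
def jointLaw (pU : U → ℝ) (pXU : U → X → ℝ) (V : X → Y → ℝ) (t : U × X × Y) : ℝ :=
  pU t.1 * pXU t.1 t.2.1 * V t.2.1 t.2.2

/-- Likelihood ratio `p(y|x) / p(y|u)`. -/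
noncomputable def ratio [Fintype X] (pXU : U → X → ℝ) (V : X → Y → ℝ) (t : U × X × Y) : ℝ :=
  V t.2.1 t.2.2 / outLaw (pXU t.1) V t.2.2

/-- `I(X;Y|U)` in nats. -/
noncomputable def natInfo [Fintype U] [Fintype X] [Fintype Y] (pU : U → ℝ) (pXU : U → X → ℝ) (V : X → Y → ℝ) : ℝ :=
  ∑ t, jointLaw pU pXU V t * Real.log (ratio pXU V t)

theorem block_ratio_eq [Fintype X] {n : ℕ} (pXU : U → X → ℝ) (V : X → Y → ℝ)
    (u : Fin n → U) (x : Fin n → X) (y : Fin n → Y) :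
    blockChannel V x y / outLaw (blockLaw fun i => pXU (u i)) (blockChannel V) y
      = ∏ i, ratio pXU V (u i, x i, y i) := by
  rw [outLaw_blockLaw]
  simp only [blockChannel, ratio, Finset.prod_div_distrib]

theorem blockLaw_mul_eq_prod_jointLaw {n : ℕ} (pU : U → ℝ) (pXU : U → X → ℝ) (V : X → Y → ℝ)
    (u : Fin n → U) (x : Fin n → X) (y : Fin n → Y) :
    (∏ i, pU (u i)) * (blockLaw (fun i => pXU (u i)) x * blockChannel V x y)
      = ∏ i, jointLaw pU pXU V (u i, x i, y i) := by
  simp only [blockLaw, blockChannel, jointLaw, Finset.prod_mul_distrib, mul_assoc]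

variable [Fintype X] [Fintype Y]

theorem ratio_nonneg {pXU : U → X → ℝ} (hX : ∀ u, pXU u ∈ stdSimplex ℝ X) {V : X → Y → ℝ}
    (hV : ∀ x, V x ∈ stdSimplex ℝ Y) (t : U × X × Y) : 0 ≤ ratio pXU V t :=
  div_nonneg ((hV _).1 _) ((outLaw_mem_stdSimplex (hX _) hV).1 _)

theorem ratio_pos_of_jointLaw_pos {pU : U → ℝ} {pXU : U → X → ℝ}
    (hX : ∀ u, pXU u ∈ stdSimplex ℝ X) {V : X → Y → ℝ} (hV : ∀ x, V x ∈ stdSimplex ℝ Y)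
    {t : U × X × Y} (ht : 0 < jointLaw pU pXU V t) : 0 < ratio pXU V t := by
  obtain ⟨u, x, y⟩ := t
  simp only [jointLaw, ratio] at ht ⊢
  have h1 : 0 < V x y := lt_of_le_of_ne ((hV x).1 y) fun h => by simp [← h] at ht
  have h2 : 0 < pXU u x := lt_of_le_of_ne ((hX u).1 x) fun h => by simp [← h] at ht
  exact div_pos h1 ((mul_pos h2 h1).trans_le (mul_le_outLaw (hX u) hV x y))

variable [Fintype U]

theorem jointLaw_mem_stdSimplex {pU : U → ℝ} (hU : pU ∈ stdSimplex ℝ U) {pXU : U → X → ℝ}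
    (hX : ∀ u, pXU u ∈ stdSimplex ℝ X) {V : X → Y → ℝ} (hV : ∀ x, V x ∈ stdSimplex ℝ Y) :
    jointLaw pU pXU V ∈ stdSimplex ℝ (U × X × Y) := by
  refine ⟨fun t => mul_nonneg (mul_nonneg (hU.1 _) ((hX _).1 _)) ((hV _).1 _), ?_⟩
  simp only [Fintype.sum_prod_type, jointLaw]
  simp_rw [← Finset.mul_sum, (hV _).2, mul_one, ← Finset.mul_sum, (hX _).2, mul_one, hU.2]

/-- Contribution of a triple to `I(X;Y|U)`, compensated so as to be nonnegative. -/
noncomputable def infoGap (pU : U → ℝ) (pXU : U → X → ℝ) (V : X → Y → ℝ) (t : U × X × Y) : ℝ :=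
  pU t.1 * pXU t.1 t.2.1 *
    (V t.2.1 t.2.2 * Real.log (ratio pXU V t) - (V t.2.1 t.2.2 - outLaw (pXU t.1) V t.2.2))

/-- Gibbs' inequality letter by letter. The compensation sums to zero, so zero information forces
every single gap to vanish. -/
theorem infoGap_nonneg {pU : U → ℝ} (hU : pU ∈ stdSimplex ℝ U) {pXU : U → X → ℝ}
    (hX : ∀ u, pXU u ∈ stdSimplex ℝ X) {V : X → Y → ℝ} (hV : ∀ x, V x ∈ stdSimplex ℝ Y)
    (t : U × X × Y) : 0 ≤ infoGap pU pXU V t := by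
  obtain ⟨u, x, y⟩ := t
  simp only [infoGap]
  rcases (mul_nonneg (hU.1 u) ((hX u).1 x)).eq_or_lt with h | h
  · simp [← h]
  refine mul_nonneg h.le (sub_nonneg.2 ?_)
  refine mul_log_div_ge_sub ((hV x).1 y) ((outLaw_mem_stdSimplex (hX u) hV).1 y) fun hq => ?_
  have h2 : pXU u x ≠ 0 := fun h' => by simp [h'] at h
  have h3 := mul_le_outLaw (hX u) hV x y
  rw [hq] at h3
  exact (mul_eq_zero.1 (le_antisymm h3 (mul_nonneg ((hX u).1 x) ((hV x).1 y)))).resolve_left h2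

theorem sum_infoGap {pU : U → ℝ} (hU : pU ∈ stdSimplex ℝ U) {pXU : U → X → ℝ}
    (hX : ∀ u, pXU u ∈ stdSimplex ℝ X) {V : X → Y → ℝ} (hV : ∀ x, V x ∈ stdSimplex ℝ Y) :
    ∑ t, infoGap pU pXU V t = natInfo pU pXU V := by
  have h1 : ∀ t, infoGap pU pXU V t = jointLaw pU pXU V t * Real.log (ratio pXU V t)
      - (jointLaw pU pXU V t - pU t.1 * pXU t.1 t.2.1 * outLaw (pXU t.1) V t.2.2) := by
    intro t; simp only [infoGap, jointLaw]; ring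
  simp_rw [h1, Finset.sum_sub_distrib]
  rw [(jointLaw_mem_stdSimplex hU hX hV).2, natInfo, sub_eq_self]
  simp only [Fintype.sum_prod_type]
  simp_rw [← Finset.mul_sum, (outLaw_mem_stdSimplex (hX _) hV).2, mul_one, ← Finset.mul_sum,
    (hX _).2, mul_one, hU.2, sub_self]

theorem natInfo_nonneg {pU : U → ℝ} (hU : pU ∈ stdSimplex ℝ U) {pXU : U → X → ℝ}
    (hX : ∀ u, pXU u ∈ stdSimplex ℝ X) {V : X → Y → ℝ} (hV : ∀ x, V x ∈ stdSimplex ℝ Y) :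
    0 ≤ natInfo pU pXU V := by
  rw [← sum_infoGap hU hX hV]
  exact Finset.sum_nonneg fun t _ => infoGap_nonneg hU hX hV t

/-- Equality case of `log x ≤ x - 1`, applied to the inverse ratio. -/
theorem ratio_eq_one_of_natInfo_eq_zero {pU : U → ℝ} (hU : pU ∈ stdSimplex ℝ U)
    {pXU : U → X → ℝ} (hX : ∀ u, pXU u ∈ stdSimplex ℝ X) {V : X → Y → ℝ}
    (hV : ∀ x, V x ∈ stdSimplex ℝ Y) (h0 : natInfo pU pXU V = 0) {t : U × X × Y}
    (ht : 0 < jointLaw pU pXU V t) : ratio pXU V t = 1 := by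
  rw [← sum_infoGap hU hX hV] at h0
  have hdt := (Finset.sum_eq_zero_iff_of_nonneg fun t _ => infoGap_nonneg hU hX hV t).1 h0 t
    (Finset.mem_univ t)
  have hρ := ratio_pos_of_jointLaw_pos hX hV ht
  obtain ⟨u, x, y⟩ := t
  simp only [infoGap, jointLaw] at hdt ht
  have h1 : 0 < V x y := lt_of_le_of_ne ((hV x).1 y) fun h => by simp [← h] at ht
  have h2 : pU u * pXU u x ≠ 0 := fun h => by simp [h] at ht
  have h3 := (mul_eq_zero.1 hdt).resolve_left h2
  by_contra hne
  have hinv : (ratio pXU V (u, x, y))⁻¹ ≠ 1 := fun h => hne (inv_eq_one.1 h)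
  have h4 := Real.log_lt_sub_one_of_pos (inv_pos.2 hρ) hinv
  have h5 : V x y * (ratio pXU V (u, x, y))⁻¹ = outLaw (pXU u) V y := by
    simp only [ratio]
    rw [inv_div, mul_div_cancel₀ _ h1.ne']
  rw [Real.log_inv] at h4
  have h6 := mul_lt_mul_of_pos_left h4 h1
  rw [mul_sub, h5] at h6
  linarith

/-- If `γ` exceeds the mean of `log ρ`, then a small tilt gives a negative exponent. -/
theorem exists_tilt_lt_one {T : Type*} [Fintype T] {w ρ : T → ℝ} (hw : w ∈ stdSimplex ℝ T)
    (hρ : ∀ t, 0 < w t → 0 < ρ t) {γ : ℝ} (hγ : ∑ t, w t * Real.log (ρ t) < γ) :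
    ∃ s : ℝ, 0 < s ∧ s ≤ 1 ∧ Real.exp (-s * γ) * ∑ t, w t * ρ t ^ s < 1 := by
  -- Moment generating function of `log ρ - γ`: it equals `1` at `0` with negative slope there.
  let h : ℝ → ℝ := fun s => ∑ t, w t * Real.exp ((Real.log (ρ t) - γ) * s)
  have hd : HasDerivAt h (∑ t, w t * (Real.log (ρ t) - γ)) 0 := by
    refine HasDerivAt.fun_sum fun t _ => ?_
    have h1 : HasDerivAt (fun s : ℝ => (Real.log (ρ t) - γ) * s) (Real.log (ρ t) - γ) 0 := by
      simpa using (hasDerivAt_id (0 : ℝ)).const_mul (Real.log (ρ t) - γ)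
    simpa using h1.exp.const_mul (w t)
  have hneg : ∑ t, w t * (Real.log (ρ t) - γ) < 0 := by
    simp_rw [mul_sub, Finset.sum_sub_distrib, ← Finset.sum_mul, hw.2]
    linarith
  have h0 : h 0 = 1 := by simp [h, hw.2]
  have hev : ∀ᶠ s in 𝓝[>] (0 : ℝ), slope h 0 s < 0 :=
    (((hasDerivAt_iff_tendsto_slope.1 hd).mono_left
      (nhdsWithin_mono _ fun x (hx : 0 < x) => hx.ne')).eventually (gt_mem_nhds hneg))
  obtain ⟨s, hs, hs0, hs1⟩ := (hev.and (Ioc_mem_nhdsGT zero_lt_one)).exists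
  refine ⟨s, hs0, hs1, ?_⟩
  have hlt : h s < 1 := by
    rw [slope_def_field, sub_zero, h0] at hs
    by_contra! hge
    exact absurd hs (not_lt.2 (div_nonneg (by linarith) hs0.le))
  refine lt_of_eq_of_lt ?_ hlt
  rw [Finset.mul_sum]
  refine Finset.sum_congr rfl fun t _ => ?_
  rcases (hw.1 t).eq_or_lt with h' | h'
  · simp [← h']
  rw [Real.rpow_def_of_pos (hρ t h'), mul_left_comm, ← Real.exp_add]
  congr 2
  ring

/-- With `y = κ * x`, subadditivity of the power `s ≤ 1` gives `s log(1 + y) ≤ log(1 + y^s) ≤ y^s`.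
-/
theorem log_one_add_mul_sub_le {κ x s : ℝ} (hκ : 0 < κ) (hκ1 : κ ≤ 1) (hx : 0 < x) (hs : 0 < s)
    (hs1 : s ≤ 1) : Real.log (1 + κ * (x - 1)) ≤ κ ^ s * x ^ s / s := by
  have h1 : 1 + κ * (x - 1) ≤ 1 + κ * x := by nlinarith
  have hy : 0 < κ * x := mul_pos hκ hx
  refine (Real.log_le_log (one_add_mul_sub_pos hκ hκ1 hx) h1).trans ?_
  rw [← Real.mul_rpow hκ.le hx.le, le_div_iff₀ hs, mul_comm, ← Real.log_rpow (by linarith)]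
  have h2 : (1 + κ * x) ^ s ≤ 1 + (κ * x) ^ s := by
    simpa using Real.rpow_add_le_add_rpow zero_le_one hy.le hs.le hs1
  have h3 := Real.log_le_log (by positivity) h2
  have h4 := Real.log_le_sub_one_of_pos (show 0 < 1 + (κ * x) ^ s by positivity)
  linarith

/-- Tensorization: independent letters turn the `n`-letter moment into an `n`th power. -/
theorem sum_block_rpow {n : ℕ} {pU : U → ℝ} {pXU : U → X → ℝ}
    {V : X → Y → ℝ} (s : ℝ) {φ : U × X × Y → ℝ} (hφ : ∀ t, 0 ≤ φ t) :
    ∑ u : Fin n → U, ∑ x : Fin n → X, ∑ y : Fin n → Y,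
        (∏ i, jointLaw pU pXU V (u i, x i, y i)) * (∏ i, φ (u i, x i, y i)) ^ s
      = (∑ t, jointLaw pU pXU V t * φ t ^ s) ^ n := by
  simp only [Fintype.sum_prod_type]
  rw [sum_sum_sum_pow n fun u x y => jointLaw pU pXU V (u, x, y) * φ (u, x, y) ^ s]
  refine Finset.sum_congr rfl fun u _ => Finset.sum_congr rfl fun x _ =>
    Finset.sum_congr rfl fun y _ => ?_
  rw [Finset.prod_mul_distrib, Real.finsetProd_rpow _ _ fun i _ => hφ _]

end Exponents

/-! ### Averaging over the time-sharing sequence. -/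

section Average

variable {X Y Z U : Type*} [Fintype X] [Fintype Y] [Fintype Z] [Fintype U] {n : ℕ}

/-- Expected leakage bound (in nats) for `n` letters and collision probability `κ`. -/
noncomputable def meanLeakage (pU : U → ℝ) (pXU : U → X → ℝ) (V : X → Z → ℝ) (n : ℕ) (κ : ℝ) : ℝ :=
  ∑ u : Fin n → U, ∑ x : Fin n → X, ∑ z : Fin n → Z,
    (∏ i, jointLaw pU pXU V (u i, x i, z i)) *
      Real.log (1 + κ * (∏ i, ratio pXU V (u i, x i, z i) - 1))

theorem jointLaw_pos_of_prod_pos {pU : U → ℝ} (hU : pU ∈ stdSimplex ℝ U) {pXU : U → X → ℝ}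
    (hX : ∀ u, pXU u ∈ stdSimplex ℝ X) {V : X → Z → ℝ} (hV : ∀ x, V x ∈ stdSimplex ℝ Z)
    {u : Fin n → U} {x : Fin n → X} {z : Fin n → Z}
    (h : 0 < ∏ i, jointLaw pU pXU V (u i, x i, z i)) (i : Fin n) :
    0 < jointLaw pU pXU V (u i, x i, z i) :=
  lt_of_le_of_ne ((jointLaw_mem_stdSimplex hU hX hV).1 _) fun h0 =>
    h.ne' (Finset.prod_eq_zero (Finset.mem_univ i) h0.symm)

theorem meanLeakage_eq_zero {pU : U → ℝ} (hU : pU ∈ stdSimplex ℝ U) {pXU : U → X → ℝ}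
    (hX : ∀ u, pXU u ∈ stdSimplex ℝ X) {V : X → Z → ℝ} (hV : ∀ x, V x ∈ stdSimplex ℝ Z)
    (h0 : natInfo pU pXU V = 0) (κ : ℝ) : meanLeakage pU pXU V n κ = 0 := by
  refine Finset.sum_eq_zero fun u _ => Finset.sum_eq_zero fun x _ =>
    Finset.sum_eq_zero fun z _ => ?_
  have hnn : 0 ≤ ∏ i, jointLaw pU pXU V (u i, x i, z i) :=
    Finset.prod_nonneg fun i _ => (jointLaw_mem_stdSimplex hU hX hV).1 _
  rcases hnn.eq_or_lt with h | h
  · rw [← h, zero_mul]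
  rw [Finset.prod_eq_one fun i _ =>
    ratio_eq_one_of_natInfo_eq_zero hU hX hV h0 (jointLaw_pos_of_prod_pos hU hX hV h i)]
  simp

theorem meanLeakage_le {pU : U → ℝ} (hU : pU ∈ stdSimplex ℝ U) {pXU : U → X → ℝ}
    (hX : ∀ u, pXU u ∈ stdSimplex ℝ X) {V : X → Z → ℝ} (hV : ∀ x, V x ∈ stdSimplex ℝ Z)
    {κ s : ℝ} (hκ : 0 < κ) (hκ1 : κ ≤ 1) (hs : 0 < s) (hs1 : s ≤ 1) :
    meanLeakage pU pXU V n κ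
      ≤ κ ^ s / s * (∑ t, jointLaw pU pXU V t * ratio pXU V t ^ s) ^ n := by
  rw [← sum_block_rpow s (ratio_nonneg hX hV)]
  simp_rw [Finset.mul_sum]
  refine Finset.sum_le_sum fun u _ => Finset.sum_le_sum fun x _ =>
    Finset.sum_le_sum fun z _ => ?_
  have hnn : 0 ≤ ∏ i, jointLaw pU pXU V (u i, x i, z i) :=
    Finset.prod_nonneg fun i _ => (jointLaw_mem_stdSimplex hU hX hV).1 _
  rcases hnn.eq_or_lt with h | h
  · simp [← h]
  have hρ : 0 < ∏ i, ratio pXU V (u i, x i, z i) := Finset.prod_pos fun i _ =>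
    ratio_pos_of_jointLaw_pos hX hV (jointLaw_pos_of_prod_pos hU hX hV h i)
  rw [mul_left_comm]
  refine mul_le_mul_of_nonneg_left ?_ hnn
  refine (log_one_add_mul_sub_le hκ hκ1 hρ hs hs1).trans (le_of_eq ?_)
  ring

/-- Existence of a code of length `n` from random coding, over a random time-sharing sequence. -/
theorem exists_code_le_meanLeakage {M K L : ℕ} [NeZero M] {W : X → Y × Z → ℝ}
    (hW : ∀ x, W x ∈ stdSimplex ℝ (Y × Z)) {q : Fin K → ℝ} (hq : q ∈ stdSimplex ℝ (Fin K))
    (g : Fin K → Fin L) {pU : U → ℝ} (hU : pU ∈ stdSimplex ℝ U) {pXU : U → X → ℝ}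
    (hX : ∀ u, pXU u ∈ stdSimplex ℝ X) {τ s : ℝ} (hτ : 0 < τ) (hs : 0 < s) :
    ∃ c : Code X Y M K n, c.errorProb W q + c.leakage W q * Real.log 2 ≤
      M * L / τ + τ ^ s * (∑ t, jointLaw pU pXU (mainChannel W) t *
        (ratio pXU (mainChannel W) t)⁻¹ ^ s) ^ n +
      meanLeakage pU pXU (tapChannel W) n (∑ j, pushLaw q g j ^ 2) := by
  set κ := ∑ j, pushLaw q g j ^ 2
  let ω : (Fin n → U) → ℝ := fun u => ∏ i, pU (u i)
  have hω : ω ∈ stdSimplex ℝ (Fin n → U) := sum_pi_prod_mem_stdSimplex fun _ => hU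
  let P : (Fin n → U) → (Fin n → X) → ℝ := fun u => blockLaw fun i => pXU (u i)
  have hP : ∀ u, P u ∈ stdSimplex ℝ (Fin n → X) := fun u =>
    blockLaw_mem_stdSimplex fun i => hX (u i)
  let be : (Fin n → U) → ℝ := fun u => ∑ x, ∑ y, P u x * blockChannel (mainChannel W) x y *
    (blockChannel (mainChannel W) x y / outLaw (P u) (blockChannel (mainChannel W)) y)⁻¹ ^ s
  let bl : (Fin n → U) → ℝ := fun u => ∑ x, ∑ z, P u x * blockChannel (tapChannel W) x z *
    Real.log (1 + κ * (blockChannel (tapChannel W) x z /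
      outLaw (P u) (blockChannel (tapChannel W)) z - 1))
  have hbe : ∑ u, ω u * be u = (∑ t, jointLaw pU pXU (mainChannel W) t *
        (ratio pXU (mainChannel W) t)⁻¹ ^ s) ^ n := by
    rw [← sum_block_rpow s fun t =>
      inv_nonneg.2 (ratio_nonneg hX (mainChannel_mem_stdSimplex hW) t)]
    simp only [be, Finset.mul_sum]
    refine Finset.sum_congr rfl fun u _ => Finset.sum_congr rfl fun x _ =>
      Finset.sum_congr rfl fun y _ => ?_
    rw [← mul_assoc, blockLaw_mul_eq_prod_jointLaw, block_ratio_eq, Finset.prod_inv_distrib]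
  have hbl : ∑ u, ω u * bl u = meanLeakage pU pXU (tapChannel W) n κ := by
    simp only [bl, Finset.mul_sum, meanLeakage]
    refine Finset.sum_congr rfl fun u _ => Finset.sum_congr rfl fun x _ =>
      Finset.sum_congr rfl fun z _ => ?_
    rw [← mul_assoc, blockLaw_mul_eq_prod_jointLaw, block_ratio_eq]
  -- One sequence `u` is fixed for good, so time sharing consumes no randomness at the encoder.
  obtain ⟨u, -, hu⟩ := exists_pos_le_of_sum_le hω (f := fun u => M * L / τ + τ ^ s * be u + bl u)
    (b := M * L / τ + τ ^ s * (∑ t, jointLaw pU pXU (mainChannel W) t *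
        (ratio pXU (mainChannel W) t)⁻¹ ^ s) ^ n + meanLeakage pU pXU (tapChannel W) n κ) (by
      simp_rw [mul_add, Finset.sum_add_distrib, mul_left_comm (ω _), ← Finset.mul_sum, hbe, hbl]
      rw [← Finset.sum_mul, hω.2, one_mul])
  obtain ⟨c, hc⟩ := exists_code_le (M := M) hW hq g (hP u) hτ hs
  exact ⟨c, hc.trans hu⟩

end Average

/-! ### Asymptotics and achievable rates. -/

section Achievability

variable {X Y Z U : Type*} [Fintype Y] [Fintype Z]

theorem natCeil_exp_le {x : ℝ} (hx : 0 ≤ x) : (⌈Real.exp x⌉₊ : ℝ) ≤ 2 * Real.exp x := by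
  have h1 := Nat.ceil_lt_add_one (Real.exp_pos x).le
  have h2 := Real.one_le_exp hx
  linarith

theorem two_rpow_eq_exp (x : ℝ) : (2 : ℝ) ^ x = Real.exp (x * Real.log 2) := by
  rw [Real.rpow_def_of_pos two_pos, mul_comm]

/-- Achievability when the randomness rate `α` (in nats) either exceeds the information leaked to
the eavesdropper by a fixed margin, or nothing is leaked. -/
theorem isAchievable_of_natInfo [Fintype X] [Fintype U] {W : X → Y × Z → ℝ}
    (hW : ∀ x, W x ∈ stdSimplex ℝ (Y × Z)) {K : ℕ → ℕ} {q : ∀ n, Fin (K n) → ℝ} (hq : ∀ n, q n ∈ stdSimplex ℝ (Fin (K n)))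
    {pU : U → ℝ} (hU : pU ∈ stdSimplex ℝ U) {pXU : U → X → ℝ}
    (hX : ∀ u, pXU u ∈ stdSimplex ℝ X) {R α : ℝ} (hR : 0 ≤ R) (hα : 0 ≤ α)
    (hqα : ∀ᶠ n : ℕ in atTop, ∑ k, q n k ^ 2 ≤ Real.exp (-(n * α)))
    (hY : R * Real.log 2 + α < natInfo pU pXU (mainChannel W))
    (hZ : natInfo pU pXU (tapChannel W) < α ∨ natInfo pU pXU (tapChannel W) = 0) :
    IsAchievable W K q R := by
  have hl : 0 < Real.log 2 := Real.log_pos one_lt_two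
  have hVY := mainChannel_mem_stdSimplex hW
  have hVZ := tapChannel_mem_stdSimplex hW
  -- The decoding threshold will be `exp (n * β)`: above the number of codewords, below the typical
  -- likelihood ratio.
  obtain ⟨β, hβ1, hβ2⟩ := exists_between hY
  obtain ⟨s, hs0, -, hs⟩ := exists_tilt_lt_one (jointLaw_mem_stdSimplex hU hX hVY)
    (ρ := fun t => (ratio pXU (mainChannel W) t)⁻¹) (γ := -β)
    (fun t ht => inv_pos.2 (ratio_pos_of_jointLaw_pos hX hVY ht)) (by
      simp only [Real.log_inv, mul_neg, Finset.sum_neg_distrib]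
      exact neg_lt_neg hβ2)
  set φY := ∑ t, jointLaw pU pXU (mainChannel W) t * (ratio pXU (mainChannel W) t)⁻¹ ^ s
    with hφY
  have hφY0 : 0 ≤ φY := Finset.sum_nonneg fun t _ =>
    mul_nonneg ((jointLaw_mem_stdSimplex hU hX hVY).1 t)
      (Real.rpow_nonneg (inv_nonneg.2 (ratio_nonneg hX hVY t)) s)
  rw [neg_mul_neg] at hs
  -- The factor `2` in the bound on `κ` adds the collision probability of the index to `1 / L`.
  have hleak : ∃ C θ : ℝ, 0 ≤ θ ∧ θ < 1 ∧ ∀ (n : ℕ) (κ : ℝ), 0 < κ → κ ≤ 1 →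
      κ ≤ 2 * Real.exp (-(n * α)) → meanLeakage pU pXU (tapChannel W) n κ ≤ C * θ ^ n := by
    rcases hZ with hZ | hZ
    · obtain ⟨v, hv0, hv1, hv⟩ := exists_tilt_lt_one (jointLaw_mem_stdSimplex hU hX hVZ)
        (ρ := ratio pXU (tapChannel W)) (fun t ht => ratio_pos_of_jointLaw_pos hX hVZ ht) hZ
      set φZ := ∑ t, jointLaw pU pXU (tapChannel W) t * ratio pXU (tapChannel W) t ^ v
      have hφZ0 : 0 ≤ φZ := Finset.sum_nonneg fun t _ =>
        mul_nonneg ((jointLaw_mem_stdSimplex hU hX hVZ).1 t)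
          (Real.rpow_nonneg (ratio_nonneg hX hVZ t) v)
      refine ⟨2 ^ v / v, Real.exp (-v * α) * φZ, by positivity, hv, fun n κ hκ hκ1 hκ2 => ?_⟩
      refine (meanLeakage_le hU hX hVZ hκ hκ1 hv0 hv1).trans ?_
      have h1 : κ ^ v ≤ 2 ^ v * Real.exp (-v * α) ^ n := by
        refine (Real.rpow_le_rpow hκ.le hκ2 hv0.le).trans (le_of_eq ?_)
        rw [Real.mul_rpow two_pos.le (Real.exp_pos _).le, ← Real.exp_mul, ← Real.exp_nat_mul]
        ring_nf
      rw [mul_pow, div_mul_eq_mul_div, div_mul_eq_mul_div, ← mul_assoc]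
      exact div_le_div_of_nonneg_right
        (mul_le_mul_of_nonneg_right h1 (pow_nonneg hφZ0 n)) hv0.le
    · exact ⟨0, 0, le_rfl, zero_lt_one, fun n κ _ _ _ => by
        rw [meanLeakage_eq_zero hU hX hVZ hZ, zero_mul]⟩
  obtain ⟨C, θ, hθ0, hθ1, hleak⟩ := hleak
  set R' := R * Real.log 2 with hR'
  have hR'0 : 0 ≤ R' := mul_nonneg hR hl.le
  -- Wrong codewords, atypical outputs, leakage. The `4` pays for rounding up `M` and `L`, a factor
  -- `2` each.
  let B : ℕ → ℝ := fun n =>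
    4 * Real.exp (R' + α - β) ^ n + (Real.exp (s * β) * φY) ^ n + C * θ ^ n
  have hB : Tendsto B atTop (𝓝 0) := by
    have h1 : Tendsto (fun n : ℕ => Real.exp (R' + α - β) ^ n) atTop (𝓝 0) :=
      tendsto_pow_atTop_nhds_zero_of_lt_one (Real.exp_pos _).le
        (by rw [← Real.exp_zero]; exact Real.exp_lt_exp.2 (by linarith))
    have h2 : Tendsto (fun n : ℕ => (Real.exp (s * β) * φY) ^ n) atTop (𝓝 0) :=
      tendsto_pow_atTop_nhds_zero_of_lt_one (by positivity) hs
    have h3 : Tendsto (fun n : ℕ => θ ^ n) atTop (𝓝 0) :=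
      tendsto_pow_atTop_nhds_zero_of_lt_one hθ0 hθ1
    simpa using ((h1.const_mul 4).add h2).add (h3.const_mul C)
  have hM0 : ∀ n : ℕ, NeZero ⌈(2 : ℝ) ^ ((n : ℝ) * R)⌉₊ := fun n =>
    ⟨(Nat.ceil_pos.2 (by positivity)).ne'⟩
  -- A code is needed at every length, but the collision hypothesis only holds eventually, so it is
  -- kept as a premise of the bound.
  have hcode : ∀ n : ℕ, ∃ c : Code X Y ⌈(2 : ℝ) ^ ((n : ℝ) * R)⌉₊ (K n) n,
      ∑ k, q n k ^ 2 ≤ Real.exp (-(n * α)) →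
        c.errorProb W (q n) + c.leakage W (q n) * Real.log 2 ≤ B n := by
    intro n
    have := hM0 n
    set M := ⌈(2 : ℝ) ^ ((n : ℝ) * R)⌉₊ with hM
    set L := ⌈Real.exp (n * α)⌉₊ with hL
    have hL0 : 0 < L := Nat.ceil_pos.2 (Real.exp_pos _)
    have : NeZero L := ⟨hL0.ne'⟩
    obtain ⟨g, hg⟩ := exists_hash_collision_le (B := Fin L) (hq n)
    have hr := pushLaw_mem_stdSimplex (hq n) g
    obtain ⟨c, hc⟩ := exists_code_le_meanLeakage (M := M) (n := n) hW (hq n) g hU hX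
      (Real.exp_pos (n * β)) hs0
    refine ⟨c, fun hqn => hc.trans (add_le_add (add_le_add ?_ ?_) ?_)⟩
    · have h1 : (M : ℝ) ≤ 2 * Real.exp (n * R') := by
        rw [hM, two_rpow_eq_exp, mul_assoc]
        exact natCeil_exp_le (by positivity)
      have h2 : (L : ℝ) ≤ 2 * Real.exp (n * α) := natCeil_exp_le (by positivity)
      rw [div_le_iff₀ (Real.exp_pos _)]
      refine (mul_le_mul h1 h2 (by positivity) (by positivity)).trans (le_of_eq ?_)
      rw [← Real.exp_nat_mul, mul_assoc 4, ← Real.exp_add, mul_mul_mul_comm, ← Real.exp_add]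
      ring_nf
    · rw [mul_pow, ← Real.exp_mul, ← Real.exp_nat_mul]
      rw [← hφY, mul_assoc, mul_comm β]
    · refine hleak n _ (sum_sq_pos hr) (sum_sq_le_one hr) (hg.trans ?_)
      have h1 : 1 / (Fintype.card (Fin L) : ℝ) ≤ Real.exp (-(n * α)) := by
        rw [Fintype.card_fin, Real.exp_neg, one_div]
        exact inv_anti₀ (Real.exp_pos _) (Nat.le_ceil _)
      linarith
  choose c hc using hcode
  have herr0 : ∀ n, 0 ≤ (c n).errorProb W (q n) := fun n => (c n).errorProb_nonneg hW (hq n)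
  have hleak0 : ∀ n, 0 ≤ (c n).leakage W (q n) := fun n => by
    have := hM0 n
    exact (c n).leakage_nonneg hW (hq n)
  refine ⟨c, ?_, ?_⟩
  · refine tendsto_of_tendsto_of_tendsto_of_le_of_le' tendsto_const_nhds hB
      (Eventually.of_forall herr0) ?_
    filter_upwards [hqα] with n hn
    have := hc n hn
    have := mul_nonneg (hleak0 n) hl.le
    linarith
  · have hB' : Tendsto (fun n => B n / Real.log 2) atTop (𝓝 0) := by
      simpa using hB.div_const (Real.log 2)
    refine tendsto_of_tendsto_of_tendsto_of_le_of_le' tendsto_const_nhds hB'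
      (Eventually.of_forall hleak0) ?_
    filter_upwards [hqα] with n hn
    have := hc n hn
    rw [le_div_iff₀ hl]
    linarith [herr0 n]

/-- With a single message there is neither error nor leakage. -/
theorem exists_code_one {M K n : ℕ} (hM : M = 1) [Nonempty X] {W : X → Y × Z → ℝ}
    (hW : ∀ x, W x ∈ stdSimplex ℝ (Y × Z)) {q : Fin K → ℝ} (hq : q ∈ stdSimplex ℝ (Fin K)) :
    ∃ c : Code X Y M K n, c.errorProb W q = 0 ∧ c.leakage W q = 0 := by
  subst hM
  let c : Code X Y 1 K n := ⟨fun _ _ _ => Classical.arbitrary X, fun _ => some 0⟩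
  refine ⟨c, by simp [Code.errorProb, c], ?_⟩
  have h := (c.tapLaw_mem_stdSimplex hW hq 0).2
  rw [Code.leakage_eq]
  simp only [mutualInfo, Fintype.card_fin, Nat.cast_one, div_one, one_mul, Finset.univ_unique,
    Fin.default_eq_zero, Finset.sum_singleton, h]
  refine Finset.sum_eq_zero fun z _ => ?_
  rcases eq_or_ne (c.tapLaw W q 0 z) 0 with h | h <;> simp [h]

/-- Every rate at most zero is achievable. -/
theorem isAchievable_of_nonpos [Nonempty X] {W : X → Y × Z → ℝ}
    (hW : ∀ x, W x ∈ stdSimplex ℝ (Y × Z)) {K : ℕ → ℕ} {q : ∀ n, Fin (K n) → ℝ}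
    (hq : ∀ n, q n ∈ stdSimplex ℝ (Fin (K n))) {R : ℝ} (hR : R ≤ 0) : IsAchievable W K q R := by
  have hM : ∀ n : ℕ, ⌈(2 : ℝ) ^ ((n : ℝ) * R)⌉₊ = 1 := fun n => by
    refine le_antisymm (Nat.ceil_le.2 ?_) (Nat.ceil_pos.2 (by positivity))
    rw [Nat.cast_one]
    exact Real.rpow_le_one_of_one_le_of_nonpos one_le_two
      (mul_nonpos_of_nonneg_of_nonpos n.cast_nonneg hR)
  choose c hc using fun n => exists_code_one (n := n) (hM n) hW (hq n)
  exact ⟨c, by simp [(hc _).1], by simp [(hc _).2]⟩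

end Achievability

/-! ### Time sharing with a constant input. -/

section TimeSharing

variable {X Y U : Type*} [Fintype X] [Fintype Y] [Fintype U]

theorem natInfo_eq_sum (pU : U → ℝ) (pXU : U → X → ℝ) (V : X → Y → ℝ) :
    natInfo pU pXU V = ∑ u, pU u * ∑ x, ∑ y, pXU u x * V x y *
      Real.log (V x y / outLaw (pXU u) V y) := by
  simp only [natInfo, jointLaw, ratio, Fintype.sum_prod_type, Finset.mul_sum, mul_assoc]

/-- Conditional mutual information, in terms of the factors of the joint law. -/
theorem condMutualInfo_mul_log_two {pU : U → ℝ} {pXU : U → X → ℝ}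
    (hX : ∀ u, pXU u ∈ stdSimplex ℝ X) {V : X → Y → ℝ} (hV : ∀ x, V x ∈ stdSimplex ℝ Y) :
    condMutualInfo (jointLaw pU pXU V) * Real.log 2 = natInfo pU pXU V := by
  have hl : Real.log 2 ≠ 0 := (Real.log_pos one_lt_two).ne'
  rw [natInfo]
  simp only [condMutualInfo, Real.logb, Fintype.sum_prod_type, ← mul_div_assoc, ← Finset.sum_div]
  rw [div_mul_cancel₀ _ hl]
  refine Finset.sum_congr rfl fun u _ => Finset.sum_congr rfl fun x _ =>
    Finset.sum_congr rfl fun y _ => ?_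
  have h1 : ∀ x, ∑ y, jointLaw pU pXU V (u, x, y) = pU u * pXU u x := fun x => by
    simp only [jointLaw]
    rw [← Finset.mul_sum, (hV x).2, mul_one]
  have h2 : ∑ x, jointLaw pU pXU V (u, x, y) = pU u * outLaw (pXU u) V y := by
    simp only [jointLaw, outLaw, Finset.mul_sum, mul_assoc]
  simp only [h1, h2, ← Finset.mul_sum, (hX u).2, mul_one]
  by_cases h0 : pU u * pXU u x = 0
  · simp [jointLaw, h0]
  congr 2
  simp only [jointLaw, ratio]
  rw [mul_assoc, mul_div_mul_left _ _ h0, mul_comm (V x y),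
    mul_div_mul_left _ _ (left_ne_zero_of_mul h0)]

variable [DecidableEq X]

/-- Time sharing with a constant input, used a fraction `ε` of the time. -/
def timeShareWeight {U : Type*} (ε : ℝ) (pU : U → ℝ) : Option U → ℝ :=
  fun u => u.elim ε fun u => (1 - ε) * pU u

/-- Input laws for time sharing with the constant input `x₀`. -/
def timeShareInput {U : Type*} (x₀ : X) (pXU : U → X → ℝ) : Option U → X → ℝ :=
  fun u => u.elim (Pi.single x₀ 1) pXU

theorem timeShareWeight_mem_stdSimplex {ε : ℝ} (h0 : 0 ≤ ε) (h1 : ε ≤ 1) {pU : U → ℝ}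
    (hU : pU ∈ stdSimplex ℝ U) : timeShareWeight ε pU ∈ stdSimplex ℝ (Option U) := by
  refine ⟨fun u => ?_, ?_⟩
  · cases u with
    | none => exact h0
    | some u => exact mul_nonneg (sub_nonneg.2 h1) (hU.1 u)
  · simp [Fintype.sum_option, timeShareWeight, ← Finset.mul_sum, hU.2]

theorem timeShareInput_mem_stdSimplex {U : Type*} (x₀ : X) {pXU : U → X → ℝ}
    (hX : ∀ u, pXU u ∈ stdSimplex ℝ X) (u : Option U) :
    timeShareInput x₀ pXU u ∈ stdSimplex ℝ X := by
  cases u with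
  | none => exact single_mem_stdSimplex ℝ x₀
  | some u => exact hX u

/-- A constant input carries no information, so the extra value of the time-sharing variable
contributes zero, whatever the channel. -/
theorem natInfo_timeShare (ε : ℝ) (x₀ : X) (pU : U → ℝ) (pXU : U → X → ℝ) (V : X → Y → ℝ) :
    natInfo (timeShareWeight ε pU) (timeShareInput x₀ pXU) V = (1 - ε) * natInfo pU pXU V := by
  have h0 : ∑ x, ∑ y, (Pi.single x₀ 1 : X → ℝ) x * V x y *
      Real.log (V x y / outLaw (Pi.single x₀ 1) V y) = 0 := by
    refine Finset.sum_eq_zero fun x _ => Finset.sum_eq_zero fun y _ => ?_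
    rcases eq_or_ne x x₀ with rfl | hx
    · have : outLaw (Pi.single x 1) V y = V x y := by simp [outLaw, Pi.single_apply]
      rw [this]
      rcases eq_or_ne (V x y) 0 with h | h <;> simp [h]
    · simp [hx]
  simp only [natInfo_eq_sum, Fintype.sum_option, timeShareWeight, timeShareInput,
    Option.elim_none, Option.elim_some, h0, mul_zero, zero_add]
  simp only [Finset.mul_sum, mul_assoc]

end TimeSharing

/-! ### Translation from bits and joint laws to nats and factors. -/

section Admissible

variable {X Y Z : Type*} [Fintype X] [Fintype Y] [Fintype Z]

theorem infoXY_eq_condMutualInfo {U : Type*} [Fintype U] {W : X → Y × Z → ℝ} {pU : U → ℝ}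
    {pXU : U → X → ℝ} {p : U × X × Y × Z → ℝ}
    (hp : ∀ u x y z, p (u, x, y, z) = pU u * pXU u x * W x (y, z)) :
    infoXY p = condMutualInfo (jointLaw pU pXU (mainChannel W)) := by
  simp only [infoXY, hp, ← Finset.mul_sum]
  rfl

theorem infoXZ_eq_condMutualInfo {U : Type*} [Fintype U] {W : X → Y × Z → ℝ} {pU : U → ℝ}
    {pXU : U → X → ℝ} {p : U × X × Y × Z → ℝ}
    (hp : ∀ u x y z, p (u, x, y, z) = pU u * pXU u x * W x (y, z)) :
    infoXZ p = condMutualInfo (jointLaw pU pXU (tapChannel W)) := by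
  simp only [infoXZ, hp, ← Finset.mul_sum]
  rfl

theorem sum_sq_le_exp_of_lt_renyiTwo {k n : ℕ} (hn : 0 < n) {q : Fin k → ℝ}
    (hq : q ∈ stdSimplex ℝ (Fin k)) {a : ℝ} (h : a < 1 / (n : ℝ) * renyiTwo q) :
    ∑ i, q i ^ 2 ≤ Real.exp (-(n * (a * Real.log 2))) := by
  have hl : 0 < Real.log 2 := Real.log_pos one_lt_two
  have hn' : (0 : ℝ) < n := by exact_mod_cast hn
  rw [renyiTwo, Real.logb, one_div, ← div_eq_inv_mul, lt_div_iff₀ hn', ← neg_div,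
    lt_div_iff₀ hl] at h
  rw [← Real.log_le_iff_le_exp (sum_sq_pos hq)]
  linarith

end Admissible

end Wiretap

/-! ### The achievability theorem. -/

theorem proposition3 {X Y Z : Type*} [Fintype X] [Fintype Y] [Fintype Z]
    (W : X → Y × Z → ℝ) (hW : ∀ x, W x ∈ stdSimplex ℝ (Y × Z))
    (K : ℕ → ℕ) (q : ∀ n, Fin (K n) → ℝ) (hq : ∀ n, q n ∈ stdSimplex ℝ (Fin (K n)))
    (R : ℝ)
    (hR : (R : EReal) < ⨆ l : ℕ, ⨆ p ∈ Wiretap.admissible W K q l,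
      ((Wiretap.infoXY p - Wiretap.infoXZ p : ℝ) : EReal)) :
    Wiretap.IsAchievable W K q R := by
  classical
  obtain ⟨l, hR⟩ := lt_iSup_iff.1 hR
  obtain ⟨p, hR⟩ := lt_iSup_iff.1 hR
  obtain ⟨⟨⟨pU, hU, pXU, hX, hp⟩, hrenyi⟩, hR⟩ := lt_iSup_iff.1 hR
  rw [EReal.coe_lt_coe_iff] at hR
  have hl : 0 < Real.log 2 := Real.log_pos one_lt_two
  have hVY := Wiretap.mainChannel_mem_stdSimplex hW
  have hVZ := Wiretap.tapChannel_mem_stdSimplex hW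
  have hY := Wiretap.condMutualInfo_mul_log_two (pU := pU) hX hVY
  have hZ := Wiretap.condMutualInfo_mul_log_two (pU := pU) hX hVZ
  rw [← Wiretap.infoXY_eq_condMutualInfo hp] at hY
  rw [← Wiretap.infoXZ_eq_condMutualInfo hp] at hZ
  obtain ⟨u₀, -, -⟩ := Wiretap.exists_pos_le_of_sum_le (f := 0) (b := 0) hU (by simp)
  obtain ⟨x₀, -, -⟩ := Wiretap.exists_pos_le_of_sum_le (f := 0) (b := 0) (hX u₀) (by simp)
  have : Nonempty X := ⟨x₀⟩
  -- For `R ≤ 0` there is one message and a trivial code; the rounding bound for `M` needs `R ≥ 0`.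
  rcases le_total R 0 with hR0 | hR0
  · exact Wiretap.isAchievable_of_nonpos hW hq hR0
  set JY := Wiretap.natInfo pU pXU (Wiretap.mainChannel W)
  set JZ := Wiretap.natInfo pU pXU (Wiretap.tapChannel W) with hJZ
  have hJZ0 : 0 ≤ JZ := Wiretap.natInfo_nonneg hU hX hVZ
  have hRJ : R * Real.log 2 + JZ < JY := by
    rw [← hY, ← hZ, ← add_mul]
    exact mul_lt_mul_of_pos_right (by linarith) hl
  have hJY0 : 0 < JY := lt_of_le_of_lt (by positivity) hRJ
  have hqα : ∀ᶠ n : ℕ in atTop, ∑ k, q n k ^ 2 ≤ Real.exp (-(n * JZ)) := by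
    filter_upwards [hrenyi, eventually_gt_atTop 0] with n hn hn0
    rw [← hZ]
    exact Wiretap.sum_sq_le_exp_of_lt_renyiTwo hn0 (hq n) hn
  -- The constant symbol is used a fraction `1 - δ / JY` of the time, which brings the main
  -- receiver's information down to exactly `δ`, still above `R * Real.log 2 + JZ`. The randomness
  -- rate stays at the original `JZ`.
  obtain ⟨δ, hδ1, hδ2⟩ := exists_between hRJ
  have hδ0 : 0 < δ := lt_of_le_of_lt (by positivity) hδ1
  have hε : 1 - (1 - δ / JY) = δ / JY := sub_sub_cancel _ _
  have hlt : δ / JY < 1 := (div_lt_one hJY0).2 hδ2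
  refine Wiretap.isAchievable_of_natInfo hW hq
    (Wiretap.timeShareWeight_mem_stdSimplex (ε := 1 - δ / JY) (sub_nonneg.2 hlt.le)
      (sub_le_self _ (by positivity)) hU)
    (Wiretap.timeShareInput_mem_stdSimplex x₀ hX) hR0 hJZ0 hqα ?_ ?_
  · rw [Wiretap.natInfo_timeShare, hε, div_mul_cancel₀ _ hJY0.ne']
    exact hδ1
  · rw [Wiretap.natInfo_timeShare, hε, ← hJZ]
    rcases hJZ0.eq_or_lt with h | h
    · exact Or.inr (by rw [← h, mul_zero])
    · exact Or.inl (mul_lt_of_lt_one_left h hlt)
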